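/- Let $k$ be an algebraically closed field of characteristic $0$ and $A_n=k[X_0,\dots,X_n]$. For a homogeneous ideal $I\subset A_n$, the cone $C(I)$ is the closed subscheme of $\mathbb A^{n+1}$ with graded ring $A_n/I$; its dimension is the Krull dimension of $A_n/I$ (by convention the empty cone, $I=A_n$, has every dimension). A cone of dimension $r$ is arithmetically Cohen–Macaulay (ACM) if its graded ring admits a regular sequence of $r$ homogeneous polynomials of positive degree (here "regular sequence" means that multiplication by each element is injective modulo the previous ones). For $r\ge 1$ these are the ACM projective subschemes of $\mathbb P^n$ of dimension $r-1$. Let $Y\subseteq X$ be cones in $\mathbb A^{n+1}$, given by homogeneous ideals $I_X\subseteq I_Y$, with $X$ ACM of dimension $r+1$ and $Y$ ACM of dimension $r$ ($r\ge 0$); thus, for $r\ge1$, $Y$ is an ACM hypersurface of the ACM projective subscheme $X\subset\mathbb P^n$. Put $A_X=A_n/I_X$, $A_Y=A_n/I_Y$, $I_{Y/X}=I_Y/I_X\subseteq A_X$. Write $R[-a]$ for the graded free module of rank one with generator in degree $a$. Then the following finite increasing sequences of natural numbers exist and are unique (in particular independent of the linear forms used to define them): * the (absolute) characteristic sequence $m_0\le\dots\le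 m_{d-1}$ of $X$: $A_X\simeq\bigoplus_{i=0}^{d-1}R[-m_i]$ as graded $R$-modules for some regular sequence $Y_0,\dots,Y_r$ of linear forms for $A_X$, where $R=k[Y_0,\dots,Y_r]$; * the relative characteristic sequence $n_0\le\dots\le n_{d-1}$ of $Y$ in $X$, which has the same length $d$: $I_{Y/X}\simeq\bigoplus_{i=0}^{d-1}R[-n_i]$ as graded $R$-modules for some such $Y_0,\dots,Y_r$, regular for $A_X$; * the absolute characteristic sequence $m'_0\le\dots\le m'_{d'-1}$ of $Y$: $A_Y\simeq\bigoplus_{j=0}^{d'-1}R'[-m'_j]$ as graded $R'$-modules for some regular sequence $Y'_0,\dots,Y'_{r-1}$ of linear forms for $A_Y$, where $R'=k[Y'_0,\dots,Y'_{r-1}]$. Moreover: 1. $n_i\ge m_i$ for all $i$, and $(m'_j)$ is the union, counted with multiplicity, $$(m_0,m_0+1,\dots,n_0-1)\oplus(m_1,\dots,n_1-1)\oplus\cdots\oplus(m_{d-1},\dots,n_{d-1}-1).$$ 2. For every $i\ge 0$, putting $c_i=\#\{j: m_j\le i\}$, $d_i=\#\{j: n_j\le i\}$ and $l'_i=\#\{j: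 m'_j=i\}$, one has $l'_i=c_i-d_i$. 3. The sequence $(l'_i)_{i\ge0}=(c_i-d_i)_{i\ge 0}$ is an O-sequence: $l'_{i+1}\le (l'_i)^{\langle i\rangle}$ for all $i\ge1$, and $l'_0=1$ if $Y$ is non-empty. Here, for $c>0$ with $i$-th Macaulay representation $c=\binom{k_i}{i}+\binom{k_{i-1}}{i-1}+\dots+\binom{k_\delta}{\delta}$, $k_i>k_{i-1}>\dots>k_\delta\ge\delta>0$, one puts $c^{\langle i\rangle}=\binom{k_i+1}{i+1}+\dots+\binom{k_\delta+1}{\delta+1}$, and $0^{\langle i\rangle}=0$. -/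

import Mathlib

open MvPolynomial

/-- The cone `C(I)` in affine space `A^{n+1}` cut out by the ideal `I` of `k[X_0, …, X_n]` has
dimension `r`: the longest chains of primes in its ring have length `r`. By convention the
empty cone (with zero ring) has every dimension. -/
def ConeHasDim {k : Type*} [Field k] {n : ℕ}
    (I : Ideal (MvPolynomial (Fin (n + 1)) k)) (r : ℕ) : Prop :=
  I = ⊤ ∨ ringKrullDim (MvPolynomial (Fin (n + 1)) k ⧸ I) = (r : WithBot ℕ∞)

/-- `I` is a homogeneous ideal (generated by homogeneous polynomials) whose cone `C(I)` is arithmetically Cohen-Macaulay of dimension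
`r`: its graded ring `A = k[X_0, …, X_n] / I` has dimension `r` and admits a regular sequence of
`r` homogeneous polynomials of positive degree. When `r ≥ 1` this is an ACM projective
subscheme of `P^n` of dimension `r - 1`. -/
structure IsACMCone {k : Type*} [Field k] {n : ℕ}
    (I : Ideal (MvPolynomial (Fin (n + 1)) k)) (r : ℕ) : Prop where
  isHomogeneous : ∃ s : Set (MvPolynomial (Fin (n + 1)) k),
    (∀ p ∈ s, ∃ e, p.IsHomogeneous e) ∧ I = Ideal.span s
  hasDim : ConeHasDim I r
  exists_regular : ∃ f : Fin r → MvPolynomial (Fin (n + 1)) k,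
    (∀ i, ∃ e, 0 < e ∧ (f i).IsHomogeneous e) ∧
    RingTheory.Sequence.IsWeaklyRegular (MvPolynomial (Fin (n + 1)) k ⧸ I) (List.ofFn f)

/-- `y_0, …, y_{r-1}` is a regular sequence of linear forms for `k[X_0, …, X_n] / I`. -/
def IsLinearRegularSeq {k : Type*} [Field k] {n : ℕ}
    (I : Ideal (MvPolynomial (Fin (n + 1)) k)) {r : ℕ}
    (y : Fin r → MvPolynomial (Fin (n + 1)) k) : Prop :=
  (∀ i, (y i).IsHomogeneous 1) ∧
  RingTheory.Sequence.IsWeaklyRegular (MvPolynomial (Fin (n + 1)) k ⧸ I) (List.ofFn y)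

/-- For a submodule (ideal) `K` of `A = k[X_0, …, X_n] / I` and linear forms `y_0, …, y_{r-1}`,
let the polynomial ring `R = k[y_0, …, y_{r-1}]` act on `A` through `R → k[X_0, …, X_n] → A`.
Then `K` is a graded free `R`-module, `K ≃ ⊕ R[-a_i]`: it has an `R`-basis of elements `b_i`
homogeneous of degree `a_i`, i.e. every element of `K` is in a unique way an `R`-linear
combination of the `b_i`. -/
def HasGradedBasis {k : Type*} [Field k] {n : ℕ}
    (I : Ideal (MvPolynomial (Fin (n + 1)) k))
    (K : Submodule (MvPolynomial (Fin (n + 1)) k) (MvPolynomial (Fin (n + 1)) k ⧸ I))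
    {r : ℕ} (y : Fin r → MvPolynomial (Fin (n + 1)) k) {d : ℕ} (a : Fin d → ℕ) : Prop :=
  ∃ b : Fin d → MvPolynomial (Fin (n + 1)) k ⧸ I,
    (∀ i, b i ∈ K ∧ ∃ p : MvPolynomial (Fin (n + 1)) k,
      p.IsHomogeneous (a i) ∧ Ideal.Quotient.mk I p = b i) ∧
    ∀ x ∈ K, ∃! c : Fin d → MvPolynomial (Fin r) k,
      ∑ i, Ideal.Quotient.mk I (aeval y (c i)) * b i = x

/-- The increasing sequence `(a_i)` is an absolute characteristic sequence of the cone
`C(I)` of dimension `r`: `A = k[X_0, …, X_n] / I ≃ ⊕ R[-a_i]` for some regular sequence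
`y_0, …, y_{r-1}` of linear forms for `A`, where `R = k[y_0, …, y_{r-1}]`. -/
def IsCharSeq {k : Type*} [Field k] {n : ℕ}
    (I : Ideal (MvPolynomial (Fin (n + 1)) k)) (r : ℕ) {d : ℕ} (a : Fin d → ℕ) : Prop :=
  Monotone a ∧ ∃ y : Fin r → MvPolynomial (Fin (n + 1)) k,
    IsLinearRegularSeq I y ∧ HasGradedBasis I ⊤ y a

/-- The increasing sequence `(a_i)` is a characteristic sequence of `Y = C(J)` relative to
`X = C(I)`, `Y ⊆ X`, where `X` has dimension `r`: the ideal `I_{Y/X} = J / I` of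
`A_X = k[X_0, …, X_n] / I` is `≃ ⊕ R[-a_i]` for some regular sequence `y_0, …, y_{r-1}` of
linear forms for `A_X`, where `R = k[y_0, …, y_{r-1}]`. -/
def IsRelCharSeq {k : Type*} [Field k] {n : ℕ}
    (I J : Ideal (MvPolynomial (Fin (n + 1)) k)) (r : ℕ) {d : ℕ} (a : Fin d → ℕ) : Prop :=
  Monotone a ∧ ∃ y : Fin r → MvPolynomial (Fin (n + 1)) k,
    IsLinearRegularSeq I y ∧ HasGradedBasis I (Submodule.map I.mkQ J) y a

/-- The `l`-th Macaulay representation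
`c = C(κ_l, l) + C(κ_{l-1}, l-1) + ⋯ + C(κ_δ, δ)` with `κ_l > ⋯ > κ_δ ≥ δ > 0`.
The empty representation (`δ > l`) is the one of `c = 0`. -/
def IsMacaulayRep (l c δ : ℕ) (κ : ℕ → ℕ) : Prop :=
  0 < δ ∧ StrictMonoOn κ (Set.Icc δ l) ∧ (δ ≤ l → δ ≤ κ δ) ∧
    c = ∑ i ∈ Finset.Icc δ l, (κ i).choose i

/-- Macaulay's growth condition `a_{l+1} ≤ a_l^{<l>}` for all `l ≥ 1`, where
`c^{<l>} = C(κ_l + 1, l + 1) + ⋯ + C(κ_δ + 1, δ + 1)` is computed from the `l`-th Macaulay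
representation of `c`, and `0^{<l>} = 0`. -/
def IsOSequence (a : ℕ → ℕ) : Prop :=
  ∀ l, 1 ≤ l → ∃ (δ : ℕ) (κ : ℕ → ℕ), IsMacaulayRep l (a l) δ κ ∧
    a (l + 1) ≤ ∑ i ∈ Finset.Icc δ l, (κ i + 1).choose (i + 1)

/-- The number of indices `j` with `a_j = i`. -/
def width {d : ℕ} (a : Fin d → ℕ) (i : ℕ) : ℕ :=
  (Finset.univ.filter fun j => a j = i).card

/-- The number of indices `j` with `a_j ≤ i`. -/
def cumWidth {d : ℕ} (a : Fin d → ℕ) (i : ℕ) : ℕ :=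
  (Finset.univ.filter fun j => a j ≤ i).card

set_option linter.unusedSimpArgs false
set_option linter.unusedSectionVars false

/-! ### Macaulay representations -/

/-! The ideal `I_{Y/X}` is the kernel of `A_X → A_Y`. Since `A_X` has a regular sequence of length
`r + 1` and `A_Y` one of length `r`, the kernel again has one of length `r + 1` (`regOn_kernel`).
Over an infinite field, avoidance of associated primes makes these sequences linear, with the one
for `A_Y` an initial segment of the one for `A_X` (`exists_linear_regOn`). By the dimension
hypotheses the three modules become finite-dimensional modulo their sequences, and a homogeneous
`k`-basis of the reduction lifts to a graded basis over the polynomial ring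
(`IsGradedBasis.of_regQuot`).

The numerical claims are read off Hilbert series: `⊕ R[-a_i]` over `s` variables has series `(∑
X^{a_i}) / (1 - X)^s`, so the `a_i` are determined. Write `m`, `n`, `m'` for the three numerators.
Additivity along the kernel sequence gives `m - n = (1 - X) m'`, and division by `1 - X` gives `c_i
- d_i = l'_i` (`cumWidth_eq_add`). Large `i` shows that the lengths agree, nonnegativity of `l'_i`
gives `m_i ≤ n_i`, and counting gives the union formula.

Finally `l'` is the Hilbert function of the reduction of `A_Y` modulo its linear regular sequence,
so it is an O-sequence by Macaulay's theorem. Standard monomials reduce that theorem to a bound on a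
set of monomials in terms of its shadow (`macaulayBound`). The bound follows by compression and a
double induction on variables and degree, through a hyperplane restriction bound in the style of
Green (`MacaulayBound.card_filter_le`). -/

/-- The value `∑ C(t_i + i, i + 1)` of the representation `t`. -/
def macVal (e : ℕ) (t : ℕ → ℕ) : ℕ := ∑ i ∈ Finset.range e, (t i).multichoose (i + 1)

/-- The growth bound of the representation `t`. -/
def macUp (e : ℕ) (t : ℕ → ℕ) : ℕ := ∑ i ∈ Finset.range e, (t i).multichoose (i + 2)

/-- The hyperplane restriction bound of the representation `t`. -/
def macRes (e : ℕ) (t : ℕ → ℕ) : ℕ := ∑ i ∈ Finset.range e, (t i - 1).multichoose (i + 1)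

/-- Hockey-stick identity; the final `1` is the term `T.multichoose 0`. -/
theorem multichoose_succ_eq_sum (T n : ℕ) :
    (T + 1).multichoose n = ∑ j ∈ Finset.range n, T.multichoose (j + 1) + 1 := by
  induction n with
  | zero => simp
  | succ n ih => rw [Nat.multichoose_succ_succ, ih, Finset.sum_range_succ]; ring

/-- Trade the lowest nonzero term, where `t s = T + 1`, for the value `T` at every index up to `s`:
by the hockey-stick identity the sum drops by exactly one. Inductions can then run over values. -/
theorem exists_macVal_pred (e : ℕ) (t : ℕ → ℕ) (ht : Monotone t) (h : 0 < macVal e t) :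
    ∃ t', Monotone t' ∧ macVal e t' + 1 = macVal e t ∧ macRes e t' ≤ macRes e t ∧
      macUp e t' < macUp e t := by
  classical
  have hex : ∃ i, i < e ∧ 0 < t i := by
    by_contra! hne
    refine h.ne' (Finset.sum_eq_zero fun i hi => ?_)
    have := hne i (Finset.mem_range.1 hi)
    rw [Nat.le_zero.1 this, Nat.multichoose_zero_succ]
  obtain ⟨s, ⟨hse, hs⟩, hmin⟩ : ∃ s, (s < e ∧ 0 < t s) ∧ ∀ i < s, t i = 0 :=
    ⟨Nat.find hex, Nat.find_spec hex, fun i hi => by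
      have h1 := Nat.find_min hex hi
      have h2 := (Nat.find_spec hex).1
      by_contra h0
      exact h1 ⟨by omega, by omega⟩⟩
  obtain ⟨T, hT⟩ : ∃ T, t s = T + 1 := ⟨t s - 1, by omega⟩
  have split : ∀ F : ℕ → ℕ → ℕ, ∀ u : ℕ → ℕ, ∑ i ∈ Finset.range e, F (u i) i =
      ∑ i ∈ Finset.range s, F (u i) i + F (u s) s + ∑ i ∈ Finset.Ico (s + 1) e, F (u i) i := by
    intro F u
    rw [← Finset.sum_range_succ, Finset.sum_range_add_sum_Ico _ (by omega)]
  have key : ∀ F : ℕ → ℕ → ℕ, ∑ i ∈ Finset.range e, F (if i ≤ s then T else t i) i =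
      ∑ i ∈ Finset.range (s + 1), F T i + ∑ i ∈ Finset.Ico (s + 1) e, F (t i) i := by
    intro F
    rw [← Finset.sum_range_add_sum_Ico _ (show s + 1 ≤ e by omega)]
    congr 1
    · refine Finset.sum_congr rfl fun i hi => ?_
      rw [if_pos (by simp at hi; omega)]
    · refine Finset.sum_congr rfl fun i hi => ?_
      rw [if_neg (by simp at hi; omega)]
  have zero : ∀ F : ℕ → ℕ → ℕ, (∀ i, F 0 i = 0) → ∑ i ∈ Finset.range s, F (t i) i = 0 := by
    intro F hF
    refine Finset.sum_eq_zero fun i hi => ?_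
    rw [hmin i (Finset.mem_range.1 hi), hF]
  refine ⟨fun i => if i ≤ s then T else t i, ?_, ?_, ?_, ?_⟩
  · intro i j hij
    have := ht hij
    by_cases hj : j ≤ s
    · simp [hj, hij.trans hj]
    · by_cases hi : i ≤ s
      · have := ht (show s ≤ j by omega)
        simp only [hi, hj, if_true, if_false]; omega
      · simpa [hi, hj] using this
  · unfold macVal
    rw [key (fun a i => a.multichoose (i + 1)), split (fun a i => a.multichoose (i + 1)) t,
      zero (fun a i => a.multichoose (i + 1)) (fun i => Nat.multichoose_zero_succ i), hT,
      multichoose_succ_eq_sum]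
    ring
  · unfold macRes
    rw [key (fun a i => (a - 1).multichoose (i + 1)),
      split (fun a i => (a - 1).multichoose (i + 1)) t,
      zero (fun a i => (a - 1).multichoose (i + 1)) (fun i => Nat.multichoose_zero_succ i), hT]
    refine Nat.add_le_add_right ?_ _
    cases T with
    | zero => simp [Nat.multichoose_zero_succ]
    | succ T => simp only [Nat.add_sub_cancel]; rw [multichoose_succ_eq_sum]; omega
  -- Here the same identity leaves a surplus of `T.multichoose 1 + 1 = T + 1`.
  · unfold macUp
    rw [key (fun a i => a.multichoose (i + 2)), split (fun a i => a.multichoose (i + 2)) t,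
      zero (fun a i => a.multichoose (i + 2)) (fun i => Nat.multichoose_zero_succ _), hT,
      multichoose_succ_eq_sum, Finset.sum_range_succ' _ (s + 1)]
    simp only [zero_add, Nat.multichoose_one_right, add_assoc, Nat.reduceAdd]
    omega

/-- Descend by predecessors from the constant sequence `c`, whose term of index `0` is already `c`.
-/
theorem exists_macVal_eq (e c : ℕ) (he : 1 ≤ e) : ∃ t, Monotone t ∧ macVal e t = c := by
  have : ∀ d, ∀ t, Monotone t → macVal e t = c + d → ∃ t, Monotone t ∧ macVal e t = c := by
    intro d
    induction d with
    | zero => exact fun t ht h => ⟨t, ht, h⟩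
    | succ d ih =>
      intro t ht h
      obtain ⟨t', ht', h1, -⟩ := exists_macVal_pred e t ht (by omega)
      exact ih t' ht' (by omega)
  have hle : c ≤ macVal e fun _ => c := by
    refine le_trans ?_ (Finset.single_le_sum (f := fun i => c.multichoose (i + 1))
      (fun _ _ => Nat.zero_le _) (Finset.mem_range.2 (show 0 < e by omega)))
    simp
  exact this _ _ monotone_const (Nat.add_sub_cancel' hle).symm

/-- A monotone `t` gives a Macaulay representation of its value. -/
theorem exists_isMacaulayRep (l : ℕ) (t : ℕ → ℕ) (ht : Monotone t) :
    ∃ δ κ, IsMacaulayRep l (macVal l t) δ κ ∧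
      macUp l t = ∑ i ∈ Finset.Icc δ l, (κ i + 1).choose (i + 1) := by
  classical
  obtain ⟨s, hsl, hpos, hmin⟩ : ∃ s, s ≤ l ∧ (s < l → 0 < t s) ∧ ∀ i < s, t i = 0 := by
    by_cases hex : ∃ i, i < l ∧ 0 < t i
    · refine ⟨Nat.find hex, (Nat.find_spec hex).1.le, fun _ => (Nat.find_spec hex).2,
        fun i hi => ?_⟩
      have h1 := Nat.find_min hex hi
      have h2 := (Nat.find_spec hex).1
      by_contra h0
      exact h1 ⟨by omega, by omega⟩
    · push Not at hex
      exact ⟨l, le_rfl, fun h => absurd h (lt_irrefl _), fun i hi => Nat.le_zero.1 (hex i hi)⟩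
  have hsum : ∀ F : ℕ → ℕ → ℕ, (∀ i, F 0 i = 0) → ∑ i ∈ Finset.range l, F (t i) i =
      ∑ i ∈ Finset.Icc (s + 1) l, F (t (i - 1)) (i - 1) := by
    intro F hF
    rw [← Finset.sum_range_add_sum_Ico _ hsl, Finset.sum_eq_zero, zero_add]
    · refine Finset.sum_bij (fun i _ => i + 1) ?_ ?_ ?_ ?_
      · intro i hi; simp at hi ⊢; omega
      · intro i _ j _ h; omega
      · intro i hi
        simp at hi
        exact ⟨i - 1, by simp; omega, by omega⟩
      · intro i _; rfl
    · intro i hi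
      rw [hmin i (Finset.mem_range.1 hi), hF]
  -- The shift by `i - 1` turns weak monotonicity of `t` into strict monotonicity of `κ`; `δ` starts
  -- just after the leading zeros of `t`.
  refine ⟨s + 1, fun i => t (i - 1) + i - 1, ⟨Nat.succ_pos _, ?_, ?_, ?_⟩, ?_⟩
  · intro i hi j hj hij
    have := ht (show i - 1 ≤ j - 1 by omega)
    simp only [Set.mem_Icc] at hi hj
    show t (i - 1) + i - 1 < t (j - 1) + j - 1
    omega
  · intro h
    have := hpos (by omega)
    simp only [Nat.add_sub_cancel]
    omega
  · unfold macVal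
    rw [hsum (fun a i => a.multichoose (i + 1)) fun i => Nat.multichoose_zero_succ i]
    refine Finset.sum_congr rfl fun i hi => ?_
    simp only [Finset.mem_Icc] at hi
    rw [Nat.sub_add_cancel (by omega), Nat.multichoose_eq]
  · unfold macUp
    rw [hsum (fun a i => a.multichoose (i + 2)) fun i => Nat.multichoose_zero_succ _]
    refine Finset.sum_congr rfl fun i hi => ?_
    simp only [Finset.mem_Icc] at hi
    have := ht (show s ≤ i - 1 by omega)
    have := hpos (by omega)
    rw [Nat.multichoose_eq]
    congr 1 <;> grind

/-! ### Shadows and compressions of sets of monomials -/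

section Shadow

variable {σ : Type*} [DecidableEq σ]

/-- The monomials obtained from those of `C` by dividing by one variable. -/
noncomputable def monoShadow (C : Finset (σ →₀ ℕ)) : Finset (σ →₀ ℕ) :=
  C.biUnion fun u => u.support.image fun i => u - Finsupp.single i 1

theorem mem_monoShadow {C : Finset (σ →₀ ℕ)} {w : σ →₀ ℕ} :
    w ∈ monoShadow C ↔ ∃ i, w + Finsupp.single i 1 ∈ C := by
  simp only [monoShadow, Finset.mem_biUnion, Finset.mem_image, Finsupp.mem_support_iff]
  constructor
  · rintro ⟨u, hu, i, hi, rfl⟩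
    refine ⟨i, ?_⟩
    rwa [tsub_add_cancel_of_le]
    rw [Finsupp.single_le_iff]; omega
  · rintro ⟨i, hi⟩
    exact ⟨_, hi, i, by simp, by simp⟩

theorem monoShadow_mono {C D : Finset (σ →₀ ℕ)} (h : C ⊆ D) : monoShadow C ⊆ monoShadow D := by
  intro w hw
  rw [mem_monoShadow] at hw ⊢
  obtain ⟨i, hi⟩ := hw
  exact ⟨i, h hi⟩

/-- `u` and `v` differ only by exchanging the variables `j` and `m`. -/
def SameLine (j m : σ) (u v : σ →₀ ℕ) : Prop :=
  u j + u m = v j + v m ∧ ∀ i, i ≠ j → i ≠ m → u i = v i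

namespace SameLine

variable {j m : σ} {u v w : σ →₀ ℕ}

theorem refl (u : σ →₀ ℕ) : SameLine j m u u := ⟨rfl, fun _ _ _ => rfl⟩

theorem symm (h : SameLine j m u v) : SameLine j m v u :=
  ⟨h.1.symm, fun i h1 h2 => (h.2 i h1 h2).symm⟩

theorem trans (h : SameLine j m u v) (h' : SameLine j m v w) : SameLine j m u w :=
  ⟨h.1.trans h'.1, fun i h1 h2 => (h.2 i h1 h2).trans (h'.2 i h1 h2)⟩

theorem eq_of_apply (h : SameLine j m u v) (hj : u j = v j) : u = v := by
  ext i
  by_cases h1 : i = j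
  · rw [h1, hj]
  · by_cases h2 : i = m
    · have := h.1
      rw [h2]; omega
    · exact h.2 i h1 h2

theorem degree_eq (hjm : j ≠ m) (h : SameLine j m u v) : u.degree = v.degree := by
  have : u + Finsupp.single j (v j) + Finsupp.single m (v m) =
      v + Finsupp.single j (u j) + Finsupp.single m (u m) := by
    ext i
    by_cases h1 : i = j
    · subst h1
      simp [hjm, hjm.symm, Nat.add_comm]
    · by_cases h2 : i = m
      · subst h2
        simp [hjm, hjm.symm, Nat.add_comm]
      · simp [h1, h2, h.2 i h1 h2, Finsupp.single_apply, Ne.symm h1, Ne.symm h2]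
  have h1 := congrArg Finsupp.degree this
  simp only [map_add, Finsupp.degree_single] at h1
  have := h.1
  omega

end SameLine

/-- The point with `j`-coordinate `b` on the line of `w`. -/
noncomputable def linePt (j m : σ) (w : σ →₀ ℕ) (b : ℕ) : σ →₀ ℕ :=
  (w.update j b).update m (w j + w m - b)

theorem linePt_left {j m : σ} (hjm : j ≠ m) (w : σ →₀ ℕ) (b : ℕ) : linePt j m w b j = b := by
  simp [linePt, Finsupp.update_apply, hjm]

theorem linePt_right {j m : σ} (w : σ →₀ ℕ) (b : ℕ) :
    linePt j m w b m = w j + w m - b := by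
  simp [linePt]

theorem linePt_other {j m i : σ} (h1 : i ≠ j) (h2 : i ≠ m) (w : σ →₀ ℕ) (b : ℕ) :
    linePt j m w b i = w i := by
  simp [linePt, Finsupp.update_apply, h1, h2]

theorem sameLine_linePt {j m : σ} (hjm : j ≠ m) (w : σ →₀ ℕ) {b : ℕ} (hb : b ≤ w j + w m) :
    SameLine j m (linePt j m w b) w := by
  refine ⟨?_, fun i h1 h2 => linePt_other h1 h2 w b⟩
  rw [linePt_left hjm, linePt_right]; omega

open Classical in
/-- The elements of `C` on the line of `u`. -/
noncomputable def lineSet (j m : σ) (C : Finset (σ →₀ ℕ)) (u : σ →₀ ℕ) : Finset (σ →₀ ℕ) :=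
  C.filter fun v => SameLine j m v u

theorem mem_lineSet {j m : σ} {C : Finset (σ →₀ ℕ)} {u v : σ →₀ ℕ} :
    v ∈ lineSet j m C u ↔ v ∈ C ∧ SameLine j m v u := by
  simp [lineSet]

theorem lineSet_congr {j m : σ} {C : Finset (σ →₀ ℕ)} {u v : σ →₀ ℕ} (h : SameLine j m u v) :
    lineSet j m C u = lineSet j m C v := by
  ext w
  rw [mem_lineSet, mem_lineSet]
  exact and_congr_right fun _ => ⟨fun h1 => h1.trans h, fun h1 => h1.trans h.symm⟩

theorem injOn_lineSet {j m : σ} {C : Finset (σ →₀ ℕ)} {u : σ →₀ ℕ} :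
    Set.InjOn (fun v : σ →₀ ℕ => v j) (lineSet j m C u) := by
  intro v hv w hw h
  have hv := (mem_lineSet.1 hv).2
  have hw := (mem_lineSet.1 hw).2
  exact (hv.trans hw.symm).eq_of_apply h

/-- The number of elements of `C` preceding `u` on its line. -/
noncomputable def lineRank (j m : σ) (C : Finset (σ →₀ ℕ)) (u : σ →₀ ℕ) : ℕ :=
  ((lineSet j m C u).filter fun v => v j < u j).card

theorem lineRank_le {j m : σ} (C : Finset (σ →₀ ℕ)) (u : σ →₀ ℕ) : lineRank j m C u ≤ u j := by
  have : Set.InjOn (fun v : σ →₀ ℕ => v j)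
      ((lineSet j m C u).filter fun v => v j < u j : Finset _) :=
    injOn_lineSet.mono (Finset.coe_subset.2 (Finset.filter_subset _ _))
  rw [lineRank, ← Finset.card_image_of_injOn this]
  refine (Finset.card_le_card (t := Finset.range (u j)) ?_).trans_eq (Finset.card_range _)
  intro a ha
  simp only [Finset.mem_image, Finset.mem_filter] at ha
  obtain ⟨v, ⟨-, hv⟩, rfl⟩ := ha
  exact Finset.mem_range.2 hv

theorem lineRank_lt {j m : σ} {C : Finset (σ →₀ ℕ)} {u v : σ →₀ ℕ} (hu : u ∈ C)
    (h : SameLine j m u v) (huv : u j < v j) : lineRank j m C u < lineRank j m C v := by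
  refine Finset.card_lt_card ⟨?_, ?_⟩
  · intro w hw
    rw [Finset.mem_filter] at hw ⊢
    exact ⟨by rw [← lineSet_congr h]; exact hw.1, hw.2.trans huv⟩
  · intro hsub
    have : u ∈ (lineSet j m C v).filter fun w => w j < v j :=
      Finset.mem_filter.2 ⟨mem_lineSet.2 ⟨hu, h⟩, huv⟩
    exact lt_irrefl _ (Finset.mem_filter.1 (hsub this)).2

theorem lineRank_lt_card {j m : σ} {C : Finset (σ →₀ ℕ)} {u : σ →₀ ℕ} (hu : u ∈ C) :
    lineRank j m C u < (lineSet j m C u).card := by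
  refine Finset.card_lt_card ⟨Finset.filter_subset _ _, fun hsub => ?_⟩
  exact lt_irrefl _ (Finset.mem_filter.1 (hsub (mem_lineSet.2 ⟨hu, SameLine.refl u⟩))).2

theorem injOn_lineRank {j m : σ} {C : Finset (σ →₀ ℕ)} {u : σ →₀ ℕ} :
    Set.InjOn (lineRank j m C) (lineSet j m C u) := by
  intro v hv w hw h
  have hv := mem_lineSet.1 hv
  have hw := mem_lineSet.1 hw
  have hvw := hv.2.trans hw.2.symm
  rcases lt_trichotomy (v j) (w j) with hlt | heq | hlt
  · exact absurd h (lineRank_lt hv.1 hvw hlt).ne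
  · exact hvw.eq_of_apply heq
  · exact absurd h (lineRank_lt hw.1 hvw.symm hlt).ne'

/-- The compression of a set of monomials in the direction of the variable `m`. -/
noncomputable def compress (j m : σ) (C : Finset (σ →₀ ℕ)) : Finset (σ →₀ ℕ) :=
  C.image fun u => linePt j m u (lineRank j m C u)

theorem sameLine_linePt_lineRank {j m : σ} (hjm : j ≠ m) (C : Finset (σ →₀ ℕ)) (u : σ →₀ ℕ) :
    SameLine j m (linePt j m u (lineRank j m C u)) u :=
  sameLine_linePt hjm u ((lineRank_le C u).trans (Nat.le_add_right _ _))

theorem injOn_compress {j m : σ} (hjm : j ≠ m) (C : Finset (σ →₀ ℕ)) :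
    Set.InjOn (fun u => linePt j m u (lineRank j m C u)) C := by
  intro u hu v hv h
  have huv : SameLine j m u v := by
    have h1 := sameLine_linePt_lineRank hjm C u
    have h2 := sameLine_linePt_lineRank hjm C v
    simp only at h
    rw [h] at h1
    exact h1.symm.trans h2
  have hr := DFunLike.congr_fun h j
  simp only [linePt_left hjm] at hr
  exact injOn_lineRank (mem_lineSet.2 ⟨hu, huv⟩) (mem_lineSet.2 ⟨hv, SameLine.refl v⟩) hr

theorem card_compress {j m : σ} (hjm : j ≠ m) (C : Finset (σ →₀ ℕ)) :
    (compress j m C).card = C.card :=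
  Finset.card_image_of_injOn (injOn_compress hjm C)

/-- Ranks on a line fill an initial interval, so compression replaces each line's points by equally
many points of smallest `j`-exponent. -/
theorem mem_compress {j m : σ} (hjm : j ≠ m) {C : Finset (σ →₀ ℕ)} {w : σ →₀ ℕ} :
    w ∈ compress j m C ↔ w j < (lineSet j m C w).card := by
  constructor
  · intro hw
    obtain ⟨u, hu, rfl⟩ := Finset.mem_image.1 hw
    rw [lineSet_congr (sameLine_linePt_lineRank hjm C u), linePt_left hjm]
    exact lineRank_lt_card hu
  · intro hw
    have hmaps : ∀ v ∈ lineSet j m C w,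
        lineRank j m C v ∈ Finset.range (lineSet j m C w).card := by
      intro v hv
      rw [Finset.mem_range, ← lineSet_congr (mem_lineSet.1 hv).2]
      exact lineRank_lt_card (mem_lineSet.1 hv).1
    have hsurj := Finset.surjOn_of_injOn_of_card_le (lineRank j m C) hmaps injOn_lineRank
      (by simp)
    obtain ⟨u, hu, hr⟩ := hsurj (Finset.mem_coe.2 (Finset.mem_range.2 hw))
    have hu := mem_lineSet.1 (Finset.mem_coe.1 hu)
    refine Finset.mem_image.2 ⟨u, hu.1, ?_⟩
    refine ((sameLine_linePt_lineRank hjm C u).trans hu.2).eq_of_apply ?_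
    rw [linePt_left hjm, hr]

/-- The line of `w` has `w j + w m + 1` points and that of `u` one more. Dividing by `m` keeps the
`j`-exponent and dividing by `j` lowers it by one, so points are lost only if the line of `u` is
full. -/
theorem card_lineSet_monoShadow {j m : σ} (hjm : j ≠ m) (C : Finset (σ →₀ ℕ)) {u w : σ →₀ ℕ}
    (hsum : u j + u m = w j + w m + 1) (hother : ∀ i, i ≠ j → i ≠ m → u i = w i) :
    min (lineSet j m C u).card (w j + w m + 1) ≤ (lineSet j m (monoShadow C) w).card := by
  set P := (lineSet j m C u).image fun v => v j with hP
  have hPcard : P.card = (lineSet j m C u).card := Finset.card_image_of_injOn injOn_lineSet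
  have hPsub : P ⊆ Finset.range (w j + w m + 2) := by
    intro a ha
    obtain ⟨v, hv, rfl⟩ := Finset.mem_image.1 ha
    have := (mem_lineSet.1 hv).2.1
    rw [Finset.mem_range]; omega
  -- Take `t` to be a gap of `P`: keeping exponents below `t` and lowering those above is injective.
  -- Without a gap, the exponent `0` is sacrificed.
  obtain ⟨t, ht, htP⟩ : ∃ t ≤ w j + w m + 1, min P.card (w j + w m + 1) ≤ (P.erase t).card := by
    by_cases hfull : P = Finset.range (w j + w m + 2)
    · refine ⟨0, Nat.zero_le _, ?_⟩
      rw [Finset.card_erase_of_mem (by rw [hfull]; simp), hfull, Finset.card_range]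
      omega
    · obtain ⟨t, ht, htP⟩ := Finset.exists_of_ssubset (hPsub.ssubset_of_ne hfull)
      refine ⟨t, by rw [Finset.mem_range] at ht; omega, ?_⟩
      rw [Finset.erase_eq_of_notMem htP]
      exact min_le_left _ _
  rw [← hPcard]
  refine htP.trans ?_
  refine Finset.card_le_card_of_injOn
    (fun a => linePt j m w (if a < t then a else a - 1)) ?_ ?_
  · intro a ha
    obtain ⟨hat, haP⟩ := Finset.mem_erase.1 ha
    obtain ⟨v, hv, rfl⟩ := Finset.mem_image.1 haP
    obtain ⟨hvC, hvu⟩ := mem_lineSet.1 hv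
    have h1 := hvu.1
    refine mem_lineSet.2 ⟨mem_monoShadow.2 ?_, sameLine_linePt hjm w ?_⟩
    · by_cases hlt : v j < t
      · refine ⟨m, ?_⟩
        simp only [if_pos hlt]
        convert hvC
        ext i
        by_cases hi : i = j
        · subst hi; simp [linePt_left hjm, hjm.symm, Finsupp.single_apply]
        · by_cases hi' : i = m
          · subst hi'; simp [linePt_right]; omega
          · simp [linePt_other hi hi', Finsupp.single_apply, Ne.symm hi',
              hvu.2 i hi hi', hother i hi hi']
      · refine ⟨j, ?_⟩
        simp only [if_neg hlt]
        convert hvC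
        ext i
        by_cases hi : i = j
        · subst hi; simp [linePt_left hjm]; omega
        · by_cases hi' : i = m
          · subst hi'; simp [linePt_right, hjm]; omega
          · simp [linePt_other hi hi', Finsupp.single_apply, Ne.symm hi,
              hvu.2 i hi hi', hother i hi hi']
    · split_ifs <;> omega
  · intro a ha b hb h
    have hat := (Finset.mem_erase.1 ha).1
    have hbt := (Finset.mem_erase.1 hb).1
    have := DFunLike.congr_fun h j
    simp only [linePt_left hjm] at this
    split_ifs at this <;> omega

/-- Compare line by line: division by `j` or `m` is covered by `card_lineSet_monoShadow`, and
division by another variable injects one line into a parallel one. -/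
theorem monoShadow_compress_subset {j m : σ} (hjm : j ≠ m) (C : Finset (σ →₀ ℕ)) :
    monoShadow (compress j m C) ⊆ compress j m (monoShadow C) := by
  intro w hw
  obtain ⟨i, hi⟩ := mem_monoShadow.1 hw
  rw [mem_compress hjm] at hi ⊢
  by_cases hij : i = j
  · subst hij
    have := card_lineSet_monoShadow hjm C (u := w + Finsupp.single i 1) (w := w)
      (by simp [hjm.symm, hjm, Finsupp.single_apply]; omega)
      (fun l h1 h2 => by simp [Finsupp.single_apply, Ne.symm h1])
    simp at hi
    omega
  · by_cases him : i = m
    · subst him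
      have := card_lineSet_monoShadow hjm C (u := w + Finsupp.single i 1) (w := w)
        (by simp [hjm.symm, hjm, Finsupp.single_apply]; omega)
        (fun l h1 h2 => by simp [Finsupp.single_apply, Ne.symm h2])
      simp [hjm, hjm.symm, Finsupp.single_apply] at hi
      omega
    · have hle : (lineSet j m C (w + Finsupp.single i 1)).card ≤
          (lineSet j m (monoShadow C) w).card := by
        have hpos : ∀ v ∈ lineSet j m C (w + Finsupp.single i 1),
            v - Finsupp.single i 1 + Finsupp.single i 1 = v := by
          intro v hv
          have := (mem_lineSet.1 hv).2.2 i hij him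
          refine tsub_add_cancel_of_le (Finsupp.single_le_iff.2 ?_)
          rw [this]; simp
        refine Finset.card_le_card_of_injOn (fun v => v - Finsupp.single i 1) ?_ ?_
        · intro v hv
          obtain ⟨hvC, hvw⟩ := mem_lineSet.1 hv
          refine mem_lineSet.2 ⟨mem_monoShadow.2 ⟨i, by rwa [hpos v hv]⟩, ?_, ?_⟩
          · have := hvw.1
            simpa [Finsupp.single_apply, hij, him, Ne.symm hij, Ne.symm him] using this
          · intro l h1 h2
            have := hvw.2 l h1 h2
            simp only [Finsupp.coe_tsub, Pi.sub_apply, this, Finsupp.coe_add, Pi.add_apply]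
            omega
        · intro v hv v' hv' h
          rw [← hpos v hv, ← hpos v' hv']
          simp only at h
          rw [h]
      simp [Finsupp.single_apply, hij] at hi
      omega

/-- Any finite set of monomials of degree `e` in the variables `s` may be replaced by one of
the same cardinality, with a shadow which is not larger, and which is stable under replacing
any variable by the variable `m`. -/
theorem exists_compressed (s : Finset σ) (m : σ) (hm : m ∈ s) (e : ℕ) (C : Finset (σ →₀ ℕ))
    (hC : ∀ u ∈ C, u.degree = e ∧ u.support ⊆ s) :
    ∃ C' : Finset (σ →₀ ℕ), (∀ u ∈ C', u.degree = e ∧ u.support ⊆ s) ∧ C'.card = C.card ∧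
      (monoShadow C').card ≤ (monoShadow C).card ∧
      ∀ v j, v + Finsupp.single j 1 ∈ C' → v + Finsupp.single m 1 ∈ C' := by
  classical
  have hdeg : ∀ u : σ →₀ ℕ, (u.degree = e ∧ u.support ⊆ s) ↔ u ∈ s.finsuppAntidiag e := by
    intro u
    rw [Finset.mem_finsuppAntidiag]
    refine and_congr_left fun hs => ?_
    rw [Finsupp.degree_apply, 
      Finset.sum_subset hs fun i _ h => Finsupp.notMem_support_iff.1 h]
  simp only [hdeg] at hC ⊢
  set F := (s.finsuppAntidiag e).powerset.filter fun D =>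
    D.card = C.card ∧ (monoShadow D).card ≤ (monoShadow C).card
  have hF : F.Nonempty := ⟨C, Finset.mem_filter.2 ⟨Finset.mem_powerset.2 hC, rfl, le_rfl⟩⟩
  -- Extremal choice: with the total exponent of `m` maximal, a failure of stability would let one
  -- compression increase it.
  obtain ⟨D, hD, hmax⟩ := Finset.exists_max_image F (fun D => ∑ u ∈ D, u m) hF
  obtain ⟨hDs, hDc, hDsh⟩ := Finset.mem_filter.1 hD
  rw [Finset.mem_powerset] at hDs
  refine ⟨D, hDs, hDc, hDsh, fun v j hv => ?_⟩
  by_cases hjm : j = m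
  · rwa [← hjm]
  by_contra hv'
  have hmem : compress j m D ∈ F := by
    refine Finset.mem_filter.2 ⟨Finset.mem_powerset.2 ?_, (card_compress hjm D).trans hDc, ?_⟩
    · intro w hw
      obtain ⟨u, hu, rfl⟩ := Finset.mem_image.1 hw
      obtain ⟨h1, h2⟩ := (hdeg u).2 (hDs hu)
      have hsl := sameLine_linePt_lineRank hjm D u
      refine (hdeg _).1 ⟨(hsl.degree_eq hjm).trans h1, fun i hi => ?_⟩
      rw [Finsupp.mem_support_iff] at hi
      by_cases him : i = m
      · rwa [him]
      · refine h2 (Finsupp.mem_support_iff.2 fun h0 => hi ?_)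
        by_cases hij : i = j
        · subst hij
          rw [linePt_left hjm]
          have := lineRank_le (j := i) (m := m) D u
          omega
        · rw [linePt_other hij him, h0]
    · exact (Finset.card_le_card (monoShadow_compress_subset hjm D)).trans
        ((card_compress hjm _).trans_le hDsh)
  have hlt : ∑ u ∈ D, u m < ∑ u ∈ compress j m D, u m := by
    rw [compress, Finset.sum_image (injOn_compress hjm D)]
    refine Finset.sum_lt_sum (fun u _ => ?_) ⟨_, hv, ?_⟩
    · rw [linePt_right]
      have := lineRank_le (j := j) (m := m) D u
      omega
    · rw [linePt_right]
      -- The point with `j`-exponent `v j` on this line is `v + single m 1`, missing from `D`; so at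
      -- most `v j` points precede, and compression moves this one strictly.
      have hr : lineRank j m D (v + Finsupp.single j 1) ≤ v j := by
        have hinj : Set.InjOn (fun w : σ →₀ ℕ => w j)
            ((lineSet j m D (v + Finsupp.single j 1)).filter
              fun w => w j < (v + Finsupp.single j 1 : σ →₀ ℕ) j : Finset _) :=
          injOn_lineSet.mono (Finset.coe_subset.2 (Finset.filter_subset _ _))
        rw [lineRank, ← Finset.card_image_of_injOn hinj]
        refine (Finset.card_le_card (t := Finset.range (v j)) ?_).trans_eq (Finset.card_range _)
        intro a ha
        obtain ⟨w, hw, rfl⟩ := Finset.mem_image.1 ha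
        obtain ⟨hw1, hw2⟩ := Finset.mem_filter.1 hw
        obtain ⟨hwD, hwl⟩ := mem_lineSet.1 hw1
        simp only [Finsupp.coe_add, Pi.add_apply, Finsupp.single_eq_same] at hw2
        refine Finset.mem_range.2 (lt_of_le_of_ne (by omega) fun heq => hv' ?_)
        convert hwD
        ext i
        by_cases hij : i = j
        · subst hij; simp [Ne.symm hjm, hjm, Finsupp.single_apply]; omega
        · by_cases him : i = m
          · subst him
            have := hwl.1
            simp [hjm, Ne.symm hjm, Finsupp.single_apply] at this ⊢
            omega
          · rw [hwl.2 i hij him]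
            simp [Finsupp.single_apply, Ne.symm hij, Ne.symm him]
      simp [hjm, Ne.symm hjm, Finsupp.single_apply] at hr ⊢
      omega
  exact absurd (hmax _ hmem) (not_le.2 hlt)

/-- `C` is stable under replacing any variable by the variable `m`. -/
def IsCompressed (m : σ) (C : Finset (σ →₀ ℕ)) : Prop :=
  ∀ v j, v + Finsupp.single j 1 ∈ C → v + Finsupp.single m 1 ∈ C

theorem IsCompressed.mem_monoShadow {m : σ} {C : Finset (σ →₀ ℕ)} (hC : IsCompressed m C)
    {v : σ →₀ ℕ} : v ∈ monoShadow C ↔ v + Finsupp.single m 1 ∈ C := by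
  rw [_root_.mem_monoShadow]
  exact ⟨fun ⟨j, hj⟩ => hC v j hj, fun h => ⟨m, h⟩⟩

theorem IsCompressed.monoShadow {m : σ} {C : Finset (σ →₀ ℕ)} (hC : IsCompressed m C) :
    IsCompressed m (monoShadow C) := by
  intro v j hv
  obtain ⟨i, hi⟩ := _root_.mem_monoShadow.1 hv
  rw [add_right_comm] at hi
  have := hC _ _ hi
  rw [add_right_comm] at this
  exact _root_.mem_monoShadow.2 ⟨i, this⟩

/-- Multiplication by the variable `m` maps the shadow bijectively onto the members divisible by
`m`. -/
theorem IsCompressed.card_eq {m : σ} {C : Finset (σ →₀ ℕ)} (hC : IsCompressed m C) :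
    C.card = (_root_.monoShadow C).card + (C.filter fun u => u m = 0).card := by
  rw [← Finset.card_filter_add_card_filter_not (s := C) fun u => u m = 0, add_comm]
  congr 1
  symm
  refine Finset.card_bij (fun v _ => v + Finsupp.single m 1) ?_ ?_ ?_
  · intro v hv
    exact Finset.mem_filter.2 ⟨hC.mem_monoShadow.1 hv, by simp⟩
  · intro v _ w _ h
    exact add_right_cancel h
  · intro u hu
    obtain ⟨huC, hum⟩ := Finset.mem_filter.1 hu
    have : u - Finsupp.single m 1 + Finsupp.single m 1 = u :=
      tsub_add_cancel_of_le (Finsupp.single_le_iff.2 (by omega))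
    exact ⟨u - Finsupp.single m 1, hC.mem_monoShadow.2 (by rwa [this]), this⟩

theorem degree_support_of_mem_monoShadow {s : Finset σ} {e : ℕ} {C : Finset (σ →₀ ℕ)}
    (hC : ∀ u ∈ C, u.degree = e + 1 ∧ u.support ⊆ s) {v : σ →₀ ℕ} (hv : v ∈ monoShadow C) :
    v.degree = e ∧ v.support ⊆ s := by
  obtain ⟨i, hi⟩ := mem_monoShadow.1 hv
  obtain ⟨h1, h2⟩ := hC _ hi
  rw [map_add, Finsupp.degree_single] at h1
  refine ⟨by omega, fun j hj => h2 ?_⟩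
  rw [Finsupp.mem_support_iff] at hj ⊢
  simp only [Finsupp.coe_add, Pi.add_apply]
  omega

/-! ### Macaulay's bound for sets of monomials -/

/-- The conclusion of Macaulay's theorem in degree `e` for the variables `s`. -/
def MacaulayBound (s : Finset σ) (e : ℕ) : Prop :=
  ∀ t, Monotone t → ∀ C : Finset (σ →₀ ℕ), (∀ u ∈ C, u.degree = e + 1 ∧ u.support ⊆ s) →
    (monoShadow C).card ≤ macVal e t → C.card ≤ macUp e t

theorem macVal_succ (e : ℕ) (t : ℕ → ℕ) :
    macVal (e + 1) t = macUp e (fun i => t (i + 1)) + t 0 := by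
  rw [macVal, Finset.sum_range_succ']
  simp [macUp]

/-- Pascal's rule in each term of positive index. Together with `macVal_succ` it compares a
representation in degree `e + 1` with its tail in degree `e`. -/
theorem macVal_succ_le (e : ℕ) (t : ℕ → ℕ) :
    macVal (e + 1) t + (t 0 - 1) ≤ macRes (e + 1) t + macVal e (fun i => t (i + 1)) + t 0 := by
  rw [macVal, macRes, macVal, Finset.sum_range_succ', Finset.sum_range_succ']
  have : ∑ k ∈ Finset.range e, (t (k + 1)).multichoose (k + 1 + 1) ≤
      ∑ k ∈ Finset.range e, (t (k + 1) - 1).multichoose (k + 1 + 1) +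
        ∑ i ∈ Finset.range e, (t (i + 1)).multichoose (i + 1) := by
    rw [← Finset.sum_add_distrib]
    refine Finset.sum_le_sum fun i _ => ?_
    cases t (i + 1) with
    | zero => simp [Nat.multichoose_zero_succ]
    | succ T => rw [Nat.multichoose_succ_succ, Nat.add_sub_cancel]
  simp only [zero_add, Nat.multichoose_one_right]
  omega

/-- Hyperplane restriction: if too many members avoid `m`, then by `card_eq` the shadow is so small
that Macaulay's bound in degree `e`, applied to the tail of `t`, forces `C` to have fewer than
`macVal (e + 1) t` elements. -/
theorem MacaulayBound.card_filter_le {s : Finset σ} {e : ℕ} (hM : MacaulayBound s e) {m : σ}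
    (N : ℕ) (t : ℕ → ℕ) (ht : Monotone t) (hN : macVal (e + 1) t = N) (C : Finset (σ →₀ ℕ))
    (hC : ∀ u ∈ C, u.degree = e + 1 ∧ u.support ⊆ s) (hcomp : IsCompressed m C)
    (hcard : C.card ≤ N) : (C.filter fun u => u m = 0).card ≤ macRes (e + 1) t := by
  induction N generalizing t with
  | zero => exact (Finset.card_filter_le _ _).trans (by omega)
  | succ N ih =>
    obtain ⟨t', ht', h1, h2, -⟩ := exists_macVal_pred (e + 1) t ht (by omega)
    by_cases hle : C.card ≤ N
    · exact (ih t' ht' (by omega) hle).trans h2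
    by_contra hlt
    have hsplit := hcomp.card_eq
    have hτ : Monotone fun i => t (i + 1) := fun i j hij => ht (Nat.succ_le_succ hij)
    have hV := macVal_succ e t
    have hV' := macVal_succ_le e t
    -- If `t 0 > 0`, the lost term `t 0` already makes the bound strict; if `t 0 = 0`, strictness
    -- comes from passing to the predecessor of the tail.
    by_cases h0 : t 0 = 0
    · obtain ⟨τ, hτm, hτ1, -, hτ3⟩ := exists_macVal_pred e _ hτ (by omega)
      have := hM τ hτm C hC (by omega)
      omega
    · have := hM _ hτ C hC (by omega)
      omega

theorem macVal_add_macUp_pred_le (e : ℕ) (t : ℕ → ℕ) :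
    macVal e t + macUp e (fun i => t i - 1) ≤ macUp e t := by
  rw [macVal, macUp, macUp, ← Finset.sum_add_distrib]
  refine Finset.sum_le_sum fun i _ => ?_
  cases t i with
  | zero => simp [Nat.multichoose_zero_succ]
  | succ T => rw [Nat.multichoose_succ_succ T (i + 1), Nat.add_sub_cancel, add_comm]

/-- **Macaulay's theorem** for sets of monomials. -/
theorem macaulayBound (s : Finset σ) (e : ℕ) : MacaulayBound s e := by
  induction s using Finset.induction_on generalizing e with
  | empty =>
    intro t _ C hC _
    rw [Finset.card_eq_zero.2 (Finset.eq_empty_of_forall_notMem fun u hu => ?_)]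
    · exact Nat.zero_le _
    · obtain ⟨h1, h2⟩ := hC u hu
      rw [Finset.subset_empty, Finsupp.support_eq_empty] at h2
      rw [h2] at h1
      simp at h1
  | insert m s hms ihs =>
    induction e with
    | zero =>
      intro t _ C hC hsh
      rw [Finset.card_eq_zero.2 (Finset.eq_empty_of_forall_notMem fun u hu => ?_)]
      · exact Nat.zero_le _
      · have hu0 : u ≠ 0 := by
          rintro rfl
          simpa using (hC _ hu).1
        obtain ⟨i, hi⟩ := Finsupp.ne_iff.1 hu0
        have : u - Finsupp.single i 1 ∈ monoShadow C :=
          mem_monoShadow.2 ⟨i, by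
            rwa [tsub_add_cancel_of_le (Finsupp.single_le_iff.2 (Nat.one_le_iff_ne_zero.2 hi))]⟩
        have := Finset.card_pos.2 ⟨_, this⟩
        simp [macVal] at hsh
        simp [hsh] at this
    | succ e ihe =>
      intro t ht C hC hsh
      obtain ⟨D, hD, hDcard, hDsh, hcomp⟩ :=
        exists_compressed (insert m s) m (Finset.mem_insert_self m s) _ C hC
      change IsCompressed m D at hcomp
      -- The members of the shadow free of `m` number at most `macRes (e + 1) t`, which is `macVal
      -- (e + 1)` of `t - 1`. They contain the shadow of the members of `D` free of `m`, so the
      -- induction on variables bounds the latter.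
      have hres := ihe.card_filter_le (m := m) _ t ht rfl (monoShadow D)
        (fun u hu => degree_support_of_mem_monoShadow hD hu) hcomp.monoShadow (hDsh.trans hsh)
      have hsub : monoShadow (D.filter fun u => u m = 0) ⊆
          (monoShadow D).filter fun u => u m = 0 := by
        intro v hv
        refine Finset.mem_filter.2 ⟨monoShadow_mono (Finset.filter_subset _ _) hv, ?_⟩
        obtain ⟨i, hi⟩ := mem_monoShadow.1 hv
        have := (Finset.mem_filter.1 hi).2
        simp only [Finsupp.coe_add, Pi.add_apply] at this
        omega
      have hH := ihs (e + 1) (fun i => t i - 1) (fun i j hij => Nat.sub_le_sub_right (ht hij) 1)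
        (D.filter fun u => u m = 0) (fun u hu => by
          obtain ⟨huD, hum⟩ := Finset.mem_filter.1 hu
          obtain ⟨h1, h2⟩ := hD u huD
          refine ⟨h1, fun i hi => (Finset.mem_insert.1 (h2 hi)).resolve_left ?_⟩
          rintro rfl
          exact Finsupp.mem_support_iff.1 hi hum)
        ((Finset.card_le_card hsub).trans hres)
      have := hcomp.card_eq
      have := macVal_add_macUp_pred_le (e + 1) t
      omega

/-- The number of monomials of each degree in a set closed under division is an O-sequence. -/
theorem isOSequence_of_monoShadow_subset [Fintype σ] (B : ℕ → Finset (σ →₀ ℕ))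
    (hdeg : ∀ l, ∀ u ∈ B l, u.degree = l) (hB : ∀ l, monoShadow (B (l + 1)) ⊆ B l) :
    IsOSequence fun l => (B l).card := by
  intro l hl
  obtain ⟨t, ht, hv⟩ := exists_macVal_eq l (B l).card hl
  obtain ⟨δ, κ, hrep, hup⟩ := exists_isMacaulayRep l t ht
  rw [hv] at hrep
  refine ⟨δ, κ, hrep, ?_⟩
  rw [← hup]
  exact macaulayBound Finset.univ l t ht _ (fun u hu => ⟨hdeg _ u hu, Finset.subset_univ _⟩)
    ((Finset.card_le_card (hB l)).trans hv.ge)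

end Shadow

/-! ### Graded pieces of ideals and standard monomials -/

section HilbertFunction

variable {σ : Type*} [Fintype σ] {k : Type*} [Field k]

/-- The homogeneous elements of degree `t` of an ideal. -/
noncomputable def homogPart (I : Ideal (MvPolynomial σ k)) (t : ℕ) :
    Submodule k (MvPolynomial σ k) :=
  homogeneousSubmodule σ k t ⊓ I.restrictScalars k

theorem mem_homogPart {I : Ideal (MvPolynomial σ k)} {t : ℕ} {p : MvPolynomial σ k} :
    p ∈ homogPart I t ↔ p.IsHomogeneous t ∧ p ∈ I := by
  rw [homogPart, Submodule.mem_inf, mem_homogeneousSubmodule, Submodule.restrictScalars_mem]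

/-- The dimension of the degree `t` part of an ideal. -/
noncomputable def homogDim (I : Ideal (MvPolynomial σ k)) (t : ℕ) : ℕ :=
  Module.finrank k (homogPart I t)

theorem homogPart_top (t : ℕ) :
    homogPart (⊤ : Ideal (MvPolynomial σ k)) t = homogeneousSubmodule σ k t := by
  ext p
  simp [mem_homogPart]

theorem homogeneousSubmodule_eq_restrictSupport [DecidableEq σ] (t : ℕ) :
    homogeneousSubmodule σ k t =
      restrictSupport k ((Finset.univ.finsuppAntidiag t : Finset (σ →₀ ℕ)) : Set (σ →₀ ℕ)) := by
  rw [homogeneousSubmodule_eq_finsupp_supported, restrictSupport]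
  congr 1
  ext u
  simp [Finset.mem_finsuppAntidiag, Finsupp.degree_eq_sum]

theorem finrank_restrictSupport (B : Finset (σ →₀ ℕ)) :
    Module.finrank k (restrictSupport k (B : Set (σ →₀ ℕ))) = B.card := by
  rw [Module.finrank_eq_card_basis (basisRestrictSupport k (B : Set (σ →₀ ℕ)))]
  simp

instance finite_homogeneousSubmodule (t : ℕ) :
    Module.Finite k (homogeneousSubmodule σ k t) :=
  Module.Finite.iff_fg.2 (homogeneousSubmodule_fg σ k t)

theorem finrank_homogeneousSubmodule (t : ℕ) :
    Module.finrank k (homogeneousSubmodule σ k t) = (Fintype.card σ).multichoose t := by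
  classical
  rw [homogeneousSubmodule_eq_restrictSupport, finrank_restrictSupport,
    Finset.card_finsuppAntidiag_nat_eq_multichoose, Finset.card_univ]

instance finite_homogPart (I : Ideal (MvPolynomial σ k)) (t : ℕ) :
    Module.Finite k (homogPart I t) :=
  Submodule.finiteDimensional_of_le (inf_le_left : homogPart I t ≤ homogeneousSubmodule σ k t)

/-- The span of the monomials of the same degree as `u` preceding `u`. -/
noncomputable def precSpan (k : Type*) [Field k] (m : MonomialOrder σ) (u : σ →₀ ℕ) :
    Submodule k (MvPolynomial σ k) :=
  restrictSupport k {v | v.degree = u.degree ∧ m.toSyn v < m.toSyn u}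

/-- The monomial `u` is not congruent modulo `Q` to a combination of preceding monomials. -/
def IsStandard (m : MonomialOrder σ) (Q : Ideal (MvPolynomial σ k)) (u : σ →₀ ℕ) : Prop :=
  monomial u (1 : k) ∉ precSpan k m u ⊔ Q.restrictScalars k

/-- Multiplying a relation by `X i` respects degree and order, so multiples of nonstandard monomials
are nonstandard: standard monomials are closed under division. -/
theorem IsStandard.of_add_single {m : MonomialOrder σ} {Q : Ideal (MvPolynomial σ k)}
    {u : σ →₀ ℕ} {i : σ} (h : IsStandard m Q (u + Finsupp.single i 1)) : IsStandard m Q u := by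
  intro hu
  obtain ⟨w, hw, q, hq, hwq⟩ := Submodule.mem_sup.1 hu
  refine h (Submodule.mem_sup.2 ⟨X i * w, ?_, X i * q, Q.mul_mem_left _ hq, ?_⟩)
  · have : precSpan k m u ≤ (precSpan k m (u + Finsupp.single i 1)).comap
        (LinearMap.mulLeft k (X i)) := by
      rw [precSpan, restrictSupport_eq_span, Submodule.span_le]
      rintro _ ⟨v, ⟨h1, h2⟩, rfl⟩
      simp only [SetLike.mem_coe, Submodule.mem_comap, LinearMap.mulLeft_apply]
      rw [X, monomial_mul, one_mul, precSpan, monomial_mem_restrictSupport]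
      left
      refine ⟨by rw [map_add, map_add, h1, add_comm], ?_⟩
      rw [map_add, map_add, add_comm]
      exact add_lt_add_left h2 _
    exact this hw
  · rw [← mul_add, hwq, X, monomial_mul, one_mul, add_comm]

open Classical in
/-- The standard monomials of degree `l` of the ideal `Q`. -/
noncomputable def standardMonomials (m : MonomialOrder σ) (Q : Ideal (MvPolynomial σ k))
    (l : ℕ) : Finset (σ →₀ ℕ) :=
  (Finset.univ.finsuppAntidiag l).filter (IsStandard m Q)

theorem mem_standardMonomials {m : MonomialOrder σ} {Q : Ideal (MvPolynomial σ k)} {l : ℕ}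
    {u : σ →₀ ℕ} : u ∈ standardMonomials m Q l ↔ u.degree = l ∧ IsStandard m Q u := by
  simp [standardMonomials, Finset.mem_finsuppAntidiag, Finsupp.degree_eq_sum]

/-- Rewriting nonstandard monomials by smaller ones of the same degree terminates, and the
corrections from `Q` stay homogeneous. -/
theorem monomial_mem_standard_sup (m : MonomialOrder σ) (Q : Ideal (MvPolynomial σ k)) {l : ℕ}
    {u : σ →₀ ℕ} (hu : u.degree = l) : monomial u (1 : k) ∈
      restrictSupport k (standardMonomials m Q l : Set (σ →₀ ℕ)) ⊔ homogPart Q l := by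
  induction h : m.toSyn u using WellFoundedLT.induction generalizing u with
  | ind s ih =>
    subst h
    by_cases hst : IsStandard m Q u
    · refine Submodule.mem_sup_left ((monomial_mem_restrictSupport k).2 (Or.inl ?_))
      exact mem_standardMonomials.2 ⟨hu, hst⟩
    · obtain ⟨w, hw, q, hq, hwq⟩ := Submodule.mem_sup.1 (not_not.1 hst)
      have hw' : w ∈ restrictSupport k (standardMonomials m Q l : Set (σ →₀ ℕ)) ⊔
          homogPart Q l := by
        refine (?_ : precSpan k m u ≤ _) hw
        rw [precSpan, restrictSupport_eq_span, Submodule.span_le]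
        rintro _ ⟨v, ⟨h1, h2⟩, rfl⟩
        exact ih _ h2 (h1.trans hu) rfl
      have hwl : w.IsHomogeneous l := by
        refine (?_ : precSpan k m u ≤ homogeneousSubmodule σ k l) hw
        rw [precSpan, restrictSupport_eq_span, Submodule.span_le]
        rintro _ ⟨v, ⟨h1, h2⟩, rfl⟩
        exact isHomogeneous_monomial _ (h1.trans hu)
      rw [← hwq]
      refine add_mem hw' (Submodule.mem_sup_right (mem_homogPart.2 ⟨?_, hq⟩))
      rw [eq_sub_of_add_eq' hwq]
      exact (isHomogeneous_monomial _ hu).sub hwl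

/-- Normalising a nonzero element of the intersection would exhibit its leading monomial as
nonstandard. -/
theorem standard_disjoint (m : MonomialOrder σ) (Q : Ideal (MvPolynomial σ k)) (l : ℕ) :
    restrictSupport k (standardMonomials m Q l : Set (σ →₀ ℕ)) ⊓ homogPart Q l = ⊥ := by
  classical
  rw [eq_bot_iff]
  rintro p ⟨hp, hpQ⟩
  rw [Submodule.mem_bot]
  by_contra hp0
  obtain ⟨u, hu, hmax⟩ := Finset.exists_max_image p.support m.toSyn (support_nonempty.2 hp0)
  have hsub := (mem_restrictSupport_iff k).1 hp
  obtain ⟨hul, hus⟩ := mem_standardMonomials.1 (hsub hu)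
  refine hus (Submodule.mem_sup.2
    ⟨monomial u 1 - (coeff u p)⁻¹ • p, ?_, (coeff u p)⁻¹ • p, ?_, sub_add_cancel _ _⟩)
  · refine (mem_restrictSupport_iff k).2 fun v hv => ?_
    have hv := mem_support_iff.1 (Finset.mem_coe.1 hv)
    rw [coeff_sub, coeff_smul, coeff_monomial] at hv
    have hvu : v ≠ u := by
      rintro rfl
      rw [if_pos rfl, smul_eq_mul, inv_mul_cancel₀ (mem_support_iff.1 hu), sub_self] at hv
      exact hv rfl
    rw [if_neg hvu.symm] at hv
    have hvp : v ∈ p.support := by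
      rw [mem_support_iff]
      intro h0
      rw [h0] at hv
      simp at hv
    refine ⟨((mem_standardMonomials.1 (hsub hvp)).1).trans hul.symm, ?_⟩
    exact lt_of_le_of_ne (hmax v hvp) fun h => hvu (m.toSyn.injective h)
  · exact Submodule.smul_mem _ _ (mem_homogPart.1 hpQ).2

theorem card_standardMonomials_add (m : MonomialOrder σ) (Q : Ideal (MvPolynomial σ k)) (l : ℕ) :
    (standardMonomials m Q l).card + homogDim Q l = homogDim (⊤ : Ideal (MvPolynomial σ k)) l := by
  classical
  have hsup : restrictSupport k (standardMonomials m Q l : Set (σ →₀ ℕ)) ⊔ homogPart Q l =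
      homogPart ⊤ l := by
    rw [homogPart_top]
    refine le_antisymm (sup_le ?_ inf_le_left) ?_
    · rw [homogeneousSubmodule_eq_restrictSupport]
      exact restrictSupport_mono k (Finset.coe_subset.2 (Finset.filter_subset _ _))
    · rw [homogeneousSubmodule_eq_restrictSupport, restrictSupport_eq_span, Submodule.span_le]
      rintro _ ⟨u, hu, rfl⟩
      refine monomial_mem_standard_sup m Q ?_
      simpa [Finset.mem_finsuppAntidiag, Finsupp.degree_eq_sum] using hu
  have hfin : Module.Finite k
      (restrictSupport k (standardMonomials m Q l : Set (σ →₀ ℕ))) :=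
    Module.Finite.of_basis (basisRestrictSupport k _)
  have := Submodule.finrank_sup_add_finrank_inf_eq
    (restrictSupport k (standardMonomials m Q l : Set (σ →₀ ℕ))) (homogPart Q l)
  rw [standard_disjoint, finrank_bot, add_zero, hsup, finrank_restrictSupport] at this
  exact this.symm

/-- **Macaulay's theorem**: the Hilbert function of a quotient of a polynomial ring is an
O-sequence. -/
theorem isOSequence_hilbert {N : ℕ} (Q : Ideal (MvPolynomial (Fin N) k)) (h : ℕ → ℕ)
    (hh : ∀ t, h t + homogDim Q t = homogDim (⊤ : Ideal (MvPolynomial (Fin N) k)) t) :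
    IsOSequence h := by
  have : h = fun l => (standardMonomials MonomialOrder.lex Q l).card := by
    ext l
    have h1 := hh l
    have h2 := card_standardMonomials_add MonomialOrder.lex Q l
    omega
  rw [this]
  refine isOSequence_of_monoShadow_subset _ (fun l u hu => (mem_standardMonomials.1 hu).1)
    fun l v hv => ?_
  obtain ⟨i, hi⟩ := mem_monoShadow.1 hv
  obtain ⟨h1, h2⟩ := mem_standardMonomials.1 hi
  rw [map_add, Finsupp.degree_single] at h1
  exact mem_standardMonomials.2 ⟨by omega, h2.of_add_single⟩

end HilbertFunction

/-! ### Regular sequences on quotients of ideals -/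

section Regular

variable {S : Type*} [CommRing S]

/-- `l` is a weakly regular sequence on `J / I`. -/
def RegOn (I J : Ideal S) : List S → Prop
  | [] => True
  | y :: l => (∀ p ∈ J, y * p ∈ I → p ∈ I) ∧ RegOn (I ⊔ Ideal.span {y} * J) J l

/-- The ideal `I + (l) J`, so that `J / I` modulo `(l)` is `J / regQuot I J l`. -/
def regQuot (I J : Ideal S) : List S → Ideal S
  | [] => I
  | y :: l => regQuot (I ⊔ Ideal.span {y} * J) J l

theorem regOn_append (I J : Ideal S) (l l' : List S) :
    RegOn I J (l ++ l') ↔ RegOn I J l ∧ RegOn (regQuot I J l) J l' := by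
  induction l generalizing I with
  | nil => simp [RegOn, regQuot]
  | cons y l ih => simp only [List.cons_append, RegOn, regQuot, ih, and_assoc]

/-- It makes the reduction of `J` a module over the reduction of the ring, whence its finiteness
over `k`. -/
theorem regQuot_mul_le {I K : Ideal S} (J : Ideal S) (h : I * J ≤ K) (l : List S) :
    regQuot I ⊤ l * J ≤ regQuot K J l := by
  induction l generalizing I K with
  | nil => exact h
  | cons y l ih =>
    refine ih ?_
    rw [Ideal.mul_top, Ideal.sup_mul]
    exact sup_le_sup_right h _

open scoped Pointwise in
theorem isWeaklyRegular_iff_regOn (I : Ideal S) (l : List S) :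
    RingTheory.Sequence.IsWeaklyRegular (S ⧸ I) l ↔ RegOn I ⊤ l := by
  induction l generalizing I with
  | nil => simp [RegOn]
  | cons y l ih =>
    rw [RingTheory.Sequence.isWeaklyRegular_cons_iff, RegOn, ← ih, Ideal.mul_top]
    refine and_congr ?_ ?_
    · rw [isSMulRegular_quotient_iff_mem_of_smul_mem]
      simp
    · have hmap : y • (⊤ : Submodule S (S ⧸ I)) =
          Submodule.map (Submodule.mkQ I) (Ideal.span {y}) := by
        have h1 : Ideal.span {y} = y • (⊤ : Submodule S S) := by
          rw [← Submodule.ideal_span_singleton_smul, smul_eq_mul, Ideal.mul_top]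
        rw [h1, Submodule.map_pointwise_smul, Submodule.map_top, Submodule.range_mkQ]
      exact LinearEquiv.isWeaklyRegular_congr
        ((Submodule.quotEquivOfEq _ _ hmap).trans
          (Submodule.quotientQuotientEquivQuotientSup I (Ideal.span {y}))) l

/-- A sequence regular on `S / I₁`, whose first part is regular on `S / (J + I₁)`, is regular on
the kernel `J / (J ∩ I₁)` of the surjection between them. -/
theorem regOn_kernel (I₁ J : Ideal S) (l : List S) (z : S) (h : RegOn I₁ ⊤ (l ++ [z]))
    (hJ : RegOn (J ⊔ I₁) ⊤ l) : RegOn (J ⊓ I₁) J (l ++ [z]) := by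
  induction l generalizing I₁ with
  | nil =>
    refine ⟨fun p hp hzp => ⟨hp, h.1 p trivial hzp.2⟩, trivial⟩
  | cons y l ih =>
    obtain ⟨h1, h2⟩ := h
    obtain ⟨h3, h4⟩ := hJ
    refine ⟨fun p hp hyp => ⟨hp, h1 p trivial hyp.2⟩, ?_⟩
    -- Reduction modulo `y` commutes with taking the kernel, because `y` is regular on the quotient
    -- `S / (J + I₁)`.
    have heq : J ⊓ I₁ ⊔ Ideal.span {y} * J = J ⊓ (I₁ ⊔ Ideal.span {y} * ⊤) := by
      refine le_antisymm (sup_le (inf_le_inf_left _ le_sup_left)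
        (le_inf Ideal.mul_le_right ((Ideal.mul_mono_right le_top).trans le_sup_right))) ?_
      rintro p ⟨hp, hp'⟩
      rw [Ideal.mul_top] at hp'
      obtain ⟨a, ha, b, hb, rfl⟩ := Submodule.mem_sup.1 hp'
      obtain ⟨q, rfl⟩ := Ideal.mem_span_singleton'.1 hb
      have hq : y * q ∈ J ⊔ I₁ := by
        have : y * q = (a + q * y) - a := by ring
        rw [this]
        exact sub_mem (Ideal.mem_sup_left hp) (Ideal.mem_sup_right ha)
      obtain ⟨c, hc, d, hd, hcd⟩ := Submodule.mem_sup.1 (h3 q trivial hq)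
      refine Submodule.mem_sup.2 ⟨a + y * d, ⟨?_, I₁.add_mem ha (I₁.mul_mem_left _ hd)⟩, y * c,
        Ideal.mul_mem_mul (Ideal.mem_span_singleton_self y) hc, ?_⟩
      · have : a + y * d = (a + q * y) - y * c := by rw [← hcd]; ring
        rw [SetLike.mem_coe, this]
        exact sub_mem hp (J.mul_mem_left _ hc)
      · rw [← hcd]; ring
    rw [heq]
    refine ih _ h2 ?_
    rwa [← sup_assoc]

/-- Each element is a nonzerodivisor on the current quotient and lowers the dimension by at least
one. -/
theorem ringKrullDim_regQuot_le (I : Ideal S) (l : List S) (h : RegOn I ⊤ l) (d : ℕ)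
    (hd : ringKrullDim (S ⧸ I) ≤ ((d + l.length : ℕ) : WithBot ℕ∞)) :
    ringKrullDim (S ⧸ regQuot I ⊤ l) ≤ (d : WithBot ℕ∞) := by
  induction l generalizing I with
  | nil => exact hd
  | cons y l ih =>
    refine ih _ h.2 ?_
    have hy : Ideal.Quotient.mk I y ∈ nonZeroDivisors (S ⧸ I) := by
      rw [mem_nonZeroDivisors_iff_right]
      intro x hx
      obtain ⟨p, rfl⟩ := Ideal.Quotient.mk_surjective x
      rw [← map_mul, Ideal.Quotient.eq_zero_iff_mem] at hx
      rw [Ideal.Quotient.eq_zero_iff_mem]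
      exact h.1 p trivial (by rwa [mul_comm])
    have h1 := ringKrullDim_quotient_succ_le_of_nonZeroDivisor hy
    have e : ((S ⧸ I) ⧸ Ideal.span {Ideal.Quotient.mk I y}) ≃+*
        S ⧸ (I ⊔ Ideal.span {y} * ⊤) :=
      (Ideal.quotEquivOfEq (by rw [Ideal.map_span, Set.image_singleton])).trans
        ((DoubleQuot.quotQuotEquivQuotSup I (Ideal.span {y})).trans
          (Ideal.quotEquivOfEq (by rw [Ideal.mul_top])))
    rw [← ringKrullDim_eq_of_ringEquiv e]
    have h2 := h1.trans hd
    rw [List.length_cons] at h2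
    have h3 : ((d + (l.length + 1) : ℕ) : WithBot ℕ∞) =
        ((d + l.length : ℕ) : WithBot ℕ∞) + 1 := by push_cast; rw [add_assoc]
    rw [h3] at h2
    exact ENat.WithBot.add_le_add_one_right_iff.1 h2

end Regular

/-! ### Homogeneous regular sequences and their replacement by linear forms -/

section GradedRegular

variable {σ : Type*} {k : Type*} [Field k]

attribute [local instance] MvPolynomial.gradedAlgebra

theorem homogeneousComponent_mul_of_isHomogeneous {f : MvPolynomial σ k} {d : ℕ}
    (hf : f.IsHomogeneous d) (q : MvPolynomial σ k) (t : ℕ) :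
    homogeneousComponent t (f * q) =
      if d ≤ t then f * homogeneousComponent (t - d) q else 0 := by
  induction q using MvPolynomial.induction_on' with
  | monomial u a =>
    have h1 := isHomogeneous_monomial (R := k) a (rfl : u.degree = u.degree)
    rw [homogeneousComponent_of_mem (hf.mul h1), homogeneousComponent_of_mem h1]
    split_ifs <;> first | rfl | omega | simp
  | add p q hp hq =>
    rw [mul_add, map_add, map_add, hp, hq]
    split_ifs <;> simp [mul_add]

theorem isHomogeneous_span_singleton {f : MvPolynomial σ k} {d : ℕ} (hf : f.IsHomogeneous d) :
    (Ideal.span {f}).IsHomogeneous (homogeneousSubmodule σ k) :=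
  Ideal.homogeneous_span _ _ (by rintro _ rfl; exact ⟨d, hf⟩)

theorem isHomogeneous_regQuot {I J : Ideal (MvPolynomial σ k)}
    (hI : I.IsHomogeneous (homogeneousSubmodule σ k))
    (hJ : J.IsHomogeneous (homogeneousSubmodule σ k)) (l : List (MvPolynomial σ k))
    (hl : ∀ y ∈ l, ∃ d, y.IsHomogeneous d) :
    (regQuot I J l).IsHomogeneous (homogeneousSubmodule σ k) := by
  induction l generalizing I with
  | nil => exact hI
  | cons y l ih =>
    obtain ⟨d, hd⟩ := hl y (List.mem_cons_self ..)
    exact ih (hI.sup ((isHomogeneous_span_singleton hd).mul hJ))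
      fun z hz => hl z (List.mem_cons_of_mem _ hz)

theorem isHomogeneous_top :
    (⊤ : Ideal (MvPolynomial σ k)).IsHomogeneous (homogeneousSubmodule σ k) :=
  Ideal.IsHomogeneous.top _

/-- A form of Nakayama's lemma for homogeneous ideals. -/
theorem le_of_le_sup_span_mul {I K : Ideal (MvPolynomial σ k)}
    (hI : I.IsHomogeneous (homogeneousSubmodule σ k)) {a : MvPolynomial σ k} {e : ℕ}
    (ha : a.IsHomogeneous e) (he : 0 < e) (hK : K ≤ I ⊔ Ideal.span {a} * K) : K ≤ I := by
  have hN : ∀ N : ℕ, K ≤ I ⊔ Ideal.span {a ^ N} * K := by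
    intro N
    induction N with
    | zero => simp
    | succ N ih =>
      refine ih.trans (sup_le le_sup_left ?_)
      refine (Ideal.mul_mono_right hK).trans ?_
      rw [Ideal.mul_sup, ← mul_assoc, Ideal.span_singleton_mul_span_singleton, ← pow_succ]
      exact sup_le_sup_right Ideal.mul_le_right _
  intro p hp
  rw [mem_iff_homogeneousComponent_mem hI]
  intro t
  obtain ⟨i, hi, b, hb, rfl⟩ := Submodule.mem_sup.1 (hN (t + 1) hp)
  obtain ⟨q, -, rfl⟩ := Ideal.mem_span_singleton_mul.1 hb
  -- Multiples of `a ^ (t + 1)` live in degrees at least `e * (t + 1) > t`.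
  rw [map_add, homogeneousComponent_mul_of_isHomogeneous (ha.pow (t + 1)), if_neg, add_zero]
  · exact homogeneousComponent_mem_of_mem hI hi t
  · nlinarith

/-- The last element of a homogeneous regular sequence may be moved to the front. -/
theorem regOn_cons_of_append {I : Ideal (MvPolynomial σ k)}
    (hI : I.IsHomogeneous (homogeneousSubmodule σ k)) (f : List (MvPolynomial σ k))
    (hf : ∀ a ∈ f, ∃ e, 0 < e ∧ a.IsHomogeneous e) (y : MvPolynomial σ k)
    (h : RegOn I ⊤ (f ++ [y])) : RegOn I ⊤ (y :: f) := by
  induction f generalizing I with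
  | nil => exact h
  | cons a f ih =>
    obtain ⟨e, he, ha⟩ := hf a (List.mem_cons_self ..)
    have hI' := hI.sup ((isHomogeneous_span_singleton ha).mul isHomogeneous_top)
    obtain ⟨h1, h2⟩ := h
    obtain ⟨h3, h4⟩ := ih hI' (fun b hb => hf b (List.mem_cons_of_mem _ hb)) h2
    rw [Ideal.mul_top] at h3
    refine ⟨fun p _ hp => ?_, fun p _ hp => ?_, ?_⟩
    -- For the colon ideal `K = (I : y)`, regularity of `y` modulo `I + (a)` and of `a` modulo `I`
    -- give `K ≤ I + a K`; the graded Nakayama lemma concludes.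
    · set K : Ideal (MvPolynomial σ k) := Submodule.comap (LinearMap.mulLeft _ y) I with hKdef
      have hK : K ≤ I ⊔ Ideal.span {a} * K := by
        intro q hq
        have hq : y * q ∈ I := hq
        obtain ⟨i, hi, b, hb, rfl⟩ := Submodule.mem_sup.1 (h3 q trivial (Ideal.mem_sup_left hq))
        obtain ⟨c, rfl⟩ := Ideal.mem_span_singleton'.1 hb
        refine add_mem (Ideal.mem_sup_left hi) (Ideal.mem_sup_right ?_)
        rw [mul_comm c a]
        refine Ideal.mul_mem_mul (Ideal.mem_span_singleton_self a) ?_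
        show y * c ∈ I
        refine h1 _ trivial ?_
        have : a * (y * c) = y * (i + c * a) - y * i := by ring
        rw [this]
        exact sub_mem hq (I.mul_mem_left _ hi)
      exact le_of_le_sup_span_mul hI ha he hK hp
    · rw [Ideal.mul_top] at hp ⊢
      obtain ⟨i, hi, b, hb, hib⟩ := Submodule.mem_sup.1 hp
      obtain ⟨q, rfl⟩ := Ideal.mem_span_singleton'.1 hb
      have hq : y * q ∈ I ⊔ Ideal.span {a} := by
        have : y * q = p * a - i := by rw [mul_comm p a, ← hib]; ring
        rw [this]
        exact sub_mem (Ideal.mem_sup_right (Ideal.mem_span_singleton'.2 ⟨p, rfl⟩))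
          (Ideal.mem_sup_left hi)
      obtain ⟨j, hj, c, hc, hjc⟩ := Submodule.mem_sup.1 (h3 q trivial hq)
      obtain ⟨g, rfl⟩ := Ideal.mem_span_singleton'.1 hc
      have hpg : p - g * y ∈ I := by
        refine h1 _ trivial ?_
        have : a * (p - g * y) = i + y * j := by
          rw [mul_sub, ← hib, ← hjc]; ring
        rw [this]
        exact I.add_mem hi (I.mul_mem_left _ hj)
      exact Submodule.mem_sup.2 ⟨_, hpg, _, Ideal.mem_span_singleton'.2 ⟨g, rfl⟩,
        sub_add_cancel _ _⟩
    · rwa [sup_right_comm]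

/-- If homogeneous polynomials of positive degree are regular on `S / I₁` and `S / I₂`, then some
linear form is regular on both. -/
theorem exists_linear_regular [Finite σ] [Infinite k] (I₁ I₂ : Ideal (MvPolynomial σ k))
    {f₁ f₂ : MvPolynomial σ k} {e₁ e₂ : ℕ} (he₁ : 0 < e₁) (he₂ : 0 < e₂)
    (hf₁ : f₁.IsHomogeneous e₁) (hf₂ : f₂.IsHomogeneous e₂) (h₁ : ∀ p, f₁ * p ∈ I₁ → p ∈ I₁)
    (h₂ : ∀ p, f₂ * p ∈ I₂ → p ∈ I₂) :
    ∃ y : MvPolynomial σ k, y.IsHomogeneous 1 ∧ (∀ p, y * p ∈ I₁ → p ∈ I₁) ∧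
      ∀ p, y * p ∈ I₂ → p ∈ I₂ := by
  classical
  set L := homogeneousSubmodule σ k 1
  have hreg : ∀ (I : Ideal (MvPolynomial σ k)) (y : MvPolynomial σ k),
      (∀ P ∈ associatedPrimes (MvPolynomial σ k) (MvPolynomial σ k ⧸ I), y ∉ P) ↔ ∀ p, y * p ∈ I → p ∈ I := by
    intro I y
    have h := biUnion_associatedPrimes_eq_compl_regular (MvPolynomial σ k) (MvPolynomial σ k ⧸ I)
    have h' := Set.ext_iff.1 h y
    simp only [Set.mem_iUnion, SetLike.mem_coe, Set.mem_compl_iff, Set.mem_ofPred_eq,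
      exists_prop, isSMulRegular_quotient_iff_mem_of_smul_mem, smul_eq_mul] at h'
    constructor
    · intro hP
      by_contra hn
      obtain ⟨P, hP1, hP2⟩ := h'.2 hn
      exact hP P hP1 hP2
    · intro hr P hP1 hP2
      exact h'.1 ⟨P, hP1, hP2⟩ hr
  -- An associated prime containing all linear forms would contain every form of positive degree, in
  -- particular the regular `f`. So it cuts out a proper subspace of linear forms, and finitely many
  -- of these do not cover the space.
  have hX : ∀ (I : Ideal (MvPolynomial σ k)) (f : MvPolynomial σ k) (e : ℕ), 0 < e → f.IsHomogeneous e →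
      (∀ p, f * p ∈ I → p ∈ I) → ∀ P ∈ associatedPrimes (MvPolynomial σ k) (MvPolynomial σ k ⧸ I),
      Submodule.comap L.subtype (P.restrictScalars k) ≠ ⊤ := by
    intro I f e he hf hr P hP htop
    refine (hreg I f).2 hr P hP ?_
    have hXP : Ideal.span (X '' (Set.univ : Set σ)) ≤ P := by
      rw [Ideal.span_le]
      rintro _ ⟨i, -, rfl⟩
      have : (⟨X i, isHomogeneous_X k i⟩ : L) ∈
          Submodule.comap L.subtype (P.restrictScalars k) := by
        rw [htop]; trivial
      exact this
    refine hXP (mem_ideal_span_X_image.2 fun u hu => ?_)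
    have hdeg : u.degree = e := by
      by_contra hne
      exact mem_support_iff.1 hu (hf.coeff_eq_zero hne)
    have hu0 : u ≠ 0 := by
      rintro rfl
      simp at hdeg
      omega
    obtain ⟨i, hi⟩ := Finsupp.ne_iff.1 hu0
    exact ⟨i, trivial, hi⟩
  have hfin : (associatedPrimes (MvPolynomial σ k) (MvPolynomial σ k ⧸ I₁) ∪ associatedPrimes (MvPolynomial σ k) (MvPolynomial σ k ⧸ I₂)).Finite :=
    (associatedPrimes.finite (MvPolynomial σ k) (MvPolynomial σ k ⧸ I₁)).union (associatedPrimes.finite (MvPolynomial σ k) (MvPolynomial σ k ⧸ I₂))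
  have htop : (⊤ : Subspace k L) ∉
      hfin.toFinset.image fun P => Submodule.comap L.subtype (P.restrictScalars k) := by
    intro hmem
    obtain ⟨P, hP, hPtop⟩ := Finset.mem_image.1 hmem
    rw [Set.Finite.mem_toFinset] at hP
    rcases hP with hP | hP
    · exact hX I₁ f₁ e₁ he₁ hf₁ h₁ P hP hPtop
    · exact hX I₂ f₂ e₂ he₂ hf₂ h₂ P hP hPtop
  have hne := Subspace.biUnion_ne_univ_of_top_notMem htop
  obtain ⟨⟨y, hy⟩, hyn⟩ := (Set.ne_univ_iff_exists_notMem _).1 hne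
  simp only [Set.mem_iUnion, not_exists, Finset.mem_image, Set.Finite.mem_toFinset,
    SetLike.mem_coe] at hyn
  refine ⟨y, hy, (hreg I₁ y).1 fun P hP hyP => ?_, (hreg I₂ y).1 fun P hP hyP => ?_⟩
  · exact hyn _ ⟨P, Or.inl hP, rfl⟩ hyP
  · exact hyn _ ⟨P, Or.inr hP, rfl⟩ hyP

/-- Homogeneous regular sequences of lengths `r + 1` and `r` on `S / I` and `S / J` may be replaced
by linear ones, the second of which is an initial segment of the first. -/
theorem exists_linear_regOn [Finite σ] [Infinite k] (r : ℕ) {I J : Ideal (MvPolynomial σ k)}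
    (hI : I.IsHomogeneous (homogeneousSubmodule σ k))
    (hJ : J.IsHomogeneous (homogeneousSubmodule σ k)) (f g : List (MvPolynomial σ k))
    (hf : ∀ a ∈ f, ∃ e, 0 < e ∧ a.IsHomogeneous e)
    (hg : ∀ a ∈ g, ∃ e, 0 < e ∧ a.IsHomogeneous e) (hfl : f.length = r + 1)
    (hgl : g.length = r) (hIf : RegOn I ⊤ f) (hJg : RegOn J ⊤ g) :
    ∃ (l : List (MvPolynomial σ k)) (z : MvPolynomial σ k), l.length = r ∧
      (∀ y ∈ l, y.IsHomogeneous 1) ∧ z.IsHomogeneous 1 ∧ RegOn I ⊤ (l ++ [z]) ∧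
      RegOn J ⊤ l := by
  induction r generalizing I J f g with
  | zero =>
    obtain ⟨a, rfl⟩ := List.length_eq_one_iff.1 hfl
    obtain ⟨e, he, ha⟩ := hf a (List.mem_singleton_self a)
    -- Only `I` needs an element here; `⊤` is a vacuous second ideal.
    obtain ⟨z, hz, hzI, -⟩ := exists_linear_regular I ⊤ he he ha ha
      (fun p hp => hIf.1 p trivial hp) fun p _ => trivial
    exact ⟨[], z, rfl, by simp, hz, ⟨fun p _ hp => hzI p hp, trivial⟩, trivial⟩
  | succ r ih =>
    obtain ⟨f', a, rfl⟩ := List.eq_nil_or_concat f |>.resolve_left (by rintro rfl; simp at hfl)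
    obtain ⟨g', b, rfl⟩ := List.eq_nil_or_concat g |>.resolve_left (by rintro rfl; simp at hgl)
    obtain ⟨e, he, ha⟩ := hf a (by simp)
    obtain ⟨e', he', hb⟩ := hg b (by simp)
    have hf' : ∀ a ∈ f', ∃ e, 0 < e ∧ a.IsHomogeneous e := fun a h => hf a (by simp [h])
    have hg' : ∀ a ∈ g', ∃ e, 0 < e ∧ a.IsHomogeneous e := fun a h => hg a (by simp [h])
    rw [List.concat_eq_append, regOn_append] at hIf hJg
    -- One linear form replaces both last elements; once it is moved to the front, the induction
    -- continues modulo it.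
    obtain ⟨y, hy, hyI, hyJ⟩ := exists_linear_regular (regQuot I ⊤ f') (regQuot J ⊤ g') he he'
      ha hb (fun p hp => hIf.2.1 p trivial hp) fun p hp => hJg.2.1 p trivial hp
    have hIy := regOn_cons_of_append hI f' hf' y
      ((regOn_append _ _ _ _).2 ⟨hIf.1, fun p _ hp => hyI p hp, trivial⟩)
    have hJy := regOn_cons_of_append hJ g' hg' y
      ((regOn_append _ _ _ _).2 ⟨hJg.1, fun p _ hp => hyJ p hp, trivial⟩)
    have hhom := (isHomogeneous_span_singleton hy).mul isHomogeneous_top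
    obtain ⟨l, z, hl, hl1, hz, hIl, hJl⟩ := ih (hI.sup hhom) (hJ.sup hhom) f' g' hf' hg'
      (by simpa using hfl) (by simpa using hgl) hIy.2 hJy.2
    refine ⟨y :: l, z, by simp [hl], ?_, hz, ⟨hIy.1, hIl⟩, hJy.1, hJl⟩
    intro w hw
    rcases List.mem_cons.1 hw with rfl | hw
    · exact hy
    · exact hl1 w hw

theorem finite_quotient_regQuot [Finite σ] (I : Ideal (MvPolynomial σ k))
    (l : List (MvPolynomial σ k)) (h : RegOn I ⊤ l)
    (hd : ringKrullDim (MvPolynomial σ k ⧸ I) ≤ (l.length : WithBot ℕ∞)) :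
    Module.Finite k (MvPolynomial σ k ⧸ regQuot I ⊤ l) := by
  have h0 := ringKrullDim_regQuot_le I l h 0 (by simpa using hd)
  have : Ring.KrullDimLE 0 (MvPolynomial σ k ⧸ regQuot I ⊤ l) :=
    Ring.krullDimLE_iff.2 (by simpa using h0)
  exact (Module.finite_iff_krullDimLE_zero k _).2 this

end GradedRegular

/-! ### Graded bases over polynomial rings in linear forms -/

section GradedBasis

variable {σ : Type*} {k : Type*} [Field k]

attribute [local instance] MvPolynomial.gradedAlgebra

/-- The `k`-linear map `c ↦ ∑ c_i(y) b_i`. -/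
noncomputable def combMap {s d : ℕ} (y : Fin s → MvPolynomial σ k)
    (b : Fin d → MvPolynomial σ k) :
    (Fin d → MvPolynomial (Fin s) k) →ₗ[k] MvPolynomial σ k :=
  ∑ i, LinearMap.mulRight k (b i) ∘ₗ (aeval y).toLinearMap ∘ₗ LinearMap.proj i

theorem combMap_apply {s d : ℕ} (y : Fin s → MvPolynomial σ k) (b : Fin d → MvPolynomial σ k)
    (c : Fin d → MvPolynomial (Fin s) k) : combMap y b c = ∑ i, aeval y (c i) * b i := by
  simp [combMap]

/-- The elements `b_i`, homogeneous of degree `a_i`, form a basis of `J / I` over the polynomial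
ring in the linear forms `y`. -/
structure IsGradedBasis (I J : Ideal (MvPolynomial σ k)) {s d : ℕ}
    (y : Fin s → MvPolynomial σ k) (a : Fin d → ℕ) (b : Fin d → MvPolynomial σ k) : Prop where
  mem : ∀ i, b i ∈ J
  hom : ∀ i, (b i).IsHomogeneous (a i)
  span : ∀ x ∈ J, ∃ c, x - combMap y b c ∈ I
  indep : ∀ c, combMap y b c ∈ I → c = 0

theorem homogeneousComponent_aeval {s : ℕ} {y : Fin s → MvPolynomial σ k}
    (hy : ∀ i, (y i).IsHomogeneous 1) (c : MvPolynomial (Fin s) k) (t : ℕ) :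
    homogeneousComponent t (aeval y c) = aeval y (homogeneousComponent t c) := by
  induction c using MvPolynomial.induction_on' with
  | monomial u a =>
    have h1 := isHomogeneous_monomial (R := k) a (rfl : u.degree = u.degree)
    have h2 := h1.aeval y hy
    rw [one_mul] at h2
    rw [homogeneousComponent_of_mem h1, homogeneousComponent_of_mem h2]
    split_ifs <;> simp
  | add p q hp hq => rw [map_add, map_add, map_add, map_add, hp, hq]

theorem homogeneousComponent_combMap {s d : ℕ} {y : Fin s → MvPolynomial σ k}
    (hy : ∀ i, (y i).IsHomogeneous 1) {a : Fin d → ℕ} {b : Fin d → MvPolynomial σ k}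
    (hb : ∀ i, (b i).IsHomogeneous (a i)) (c : Fin d → MvPolynomial (Fin s) k) (t : ℕ) :
    homogeneousComponent t (combMap y b c) =
      combMap y b fun i => if a i ≤ t then homogeneousComponent (t - a i) (c i) else 0 := by
  rw [combMap_apply, combMap_apply, map_sum]
  refine Finset.sum_congr rfl fun i _ => ?_
  rw [mul_comm, homogeneousComponent_mul_of_isHomogeneous (hb i)]
  split_ifs
  · rw [homogeneousComponent_aeval hy, mul_comm]
  · simp

/-- The Hilbert function of a graded free module. -/
theorem IsGradedBasis.homogDim_eq [Fintype σ] {I J : Ideal (MvPolynomial σ k)} {s d : ℕ}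
    {y : Fin s → MvPolynomial σ k} {a : Fin d → ℕ} {b : Fin d → MvPolynomial σ k}
    (h : IsGradedBasis I J y a b) (hI : I.IsHomogeneous (homogeneousSubmodule σ k)) (hIJ : I ≤ J)
    (hy : ∀ i, (y i).IsHomogeneous 1) (t : ℕ) :
    homogDim J t = homogDim I t + ∑ i, if a i ≤ t then s.multichoose (t - a i) else 0 := by
  classical
  -- The coefficients contributing in degree `t`: the `i`-th is homogeneous of degree `t - a i`, or
  -- zero when `a i > t`.
  set G : Fin d → Submodule k (MvPolynomial (Fin s) k) := fun i =>
    if a i ≤ t then homogeneousSubmodule (Fin s) k (t - a i) else ⊥ with hG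
  have hGpos : ∀ i, a i ≤ t → G i = homogeneousSubmodule (Fin s) k (t - a i) :=
    fun i hi => if_pos hi
  have hGneg : ∀ i, ¬a i ≤ t → G i = ⊥ := fun i hi => if_neg hi
  have hGfin : ∀ i, Module.Finite k (G i) := by
    intro i
    by_cases hai : a i ≤ t
    · rw [hGpos i hai]; infer_instance
    · rw [hGneg i hai]; infer_instance
  set Φ : (∀ i, G i) →ₗ[k] MvPolynomial σ k :=
    combMap y b ∘ₗ LinearMap.pi fun i => (G i).subtype ∘ₗ LinearMap.proj i with hΦ
  have hΦapp : ∀ c : ∀ i, G i, Φ c = combMap y b fun i => (c i : MvPolynomial (Fin s) k) :=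
    fun c => rfl
  have hmemI : ∀ c, Φ c ∈ I → c = 0 := by
    intro c hc
    have := h.indep _ hc
    ext i : 1
    exact Subtype.ext (congrFun this i)
  have hinj : Function.Injective Φ := by
    rw [injective_iff_map_eq_zero]
    exact fun c hc => hmemI c (by rw [hc]; exact I.zero_mem)
  have hcomp : ∀ c : ∀ i, G i, (Φ c).IsHomogeneous t := by
    intro c
    rw [hΦapp, combMap_apply]
    refine IsHomogeneous.sum _ _ _ fun i _ => ?_
    by_cases hai : a i ≤ t
    · have hc := (hGpos i hai).le (c i).2
      have h1 := ((IsHomogeneous.aeval hc y hy).mul (h.hom i))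
      rwa [one_mul, Nat.sub_add_cancel hai] at h1
    · have hc := (Submodule.mem_bot k).1 ((hGneg i hai).le (c i).2)
      rw [hc, map_zero, zero_mul]
      exact isHomogeneous_zero _ _ _
  have hΦJ : ∀ c, Φ c ∈ J := by
    intro c
    rw [hΦapp, combMap_apply]
    exact J.sum_mem fun i _ => J.mul_mem_left _ (h.mem i)
  have hsup : homogPart I t ⊔ LinearMap.range Φ = homogPart J t := by
    refine le_antisymm (sup_le ?_ ?_) ?_
    · intro p hp
      rw [mem_homogPart] at hp ⊢
      exact ⟨hp.1, hIJ hp.2⟩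
    · rintro _ ⟨c, rfl⟩
      exact mem_homogPart.2 ⟨hcomp c, hΦJ c⟩
    · intro x hx
      obtain ⟨hx1, hx2⟩ := mem_homogPart.1 hx
      obtain ⟨c, hc⟩ := h.span x hx2
      have hc' := homogeneousComponent_mem_of_mem hI hc t
      rw [map_sub, homogeneousComponent_eq_self hx1, homogeneousComponent_combMap hy h.hom] at hc'
      have hcG : ∀ i, (if a i ≤ t then homogeneousComponent (t - a i) (c i) else 0) ∈ G i := by
        intro i
        by_cases hai : a i ≤ t
        · rw [if_pos hai, hGpos i hai]
          exact homogeneousComponent_mem _ _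
        · rw [if_neg hai]
          exact zero_mem _
      have h1 : Φ (fun i => ⟨_, hcG i⟩) =
        combMap y b fun i => if a i ≤ t then homogeneousComponent (t - a i) (c i) else 0 := rfl
      rw [← h1] at hc'
      refine Submodule.mem_sup.2 ⟨_, mem_homogPart.2 ⟨hx1.sub (hcomp _), hc'⟩, _, ⟨_, rfl⟩,
        sub_add_cancel _ _⟩
  have hinf : homogPart I t ⊓ LinearMap.range Φ = ⊥ := by
    rw [eq_bot_iff]
    rintro _ ⟨h1, c, rfl⟩
    rw [Submodule.mem_bot, hmemI c (mem_homogPart.1 h1).2, map_zero]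
  have hfr := Submodule.finrank_sup_add_finrank_inf_eq (homogPart I t) (LinearMap.range Φ)
  rw [hsup, hinf, finrank_bot, add_zero, LinearMap.finrank_range_of_inj hinj,
    Module.finrank_pi_fintype] at hfr
  rw [homogDim, hfr, homogDim]
  congr 1
  refine Finset.sum_congr rfl fun i _ => ?_
  by_cases hai : a i ≤ t
  · rw [if_pos hai, hGpos i hai, finrank_homogeneousSubmodule, Fintype.card_fin]
  · rw [if_neg hai, hGneg i hai, finrank_bot]

theorem aeval_finSuccEquiv_symm_C {s : ℕ} (y : Fin (s + 1) → MvPolynomial σ k)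
    (c : MvPolynomial (Fin s) k) :
    aeval y ((finSuccEquiv k s).symm (Polynomial.C c)) = aeval (fun i => y i.succ) c := by
  have : (finSuccEquiv k s).symm (Polynomial.C c) = rename Fin.succ c := by
    rw [AlgEquiv.symm_apply_eq]
    induction c using MvPolynomial.induction_on with
    | C a => simp [finSuccEquiv_apply]
    | add p q hp hq => rw [map_add, map_add, map_add, hp, hq]
    | mul_X p i hp => rw [map_mul, map_mul, map_mul, hp, rename_X, finSuccEquiv_X_succ]
  rw [this, aeval_rename]
  rfl

theorem aeval_finSuccEquiv_symm_mul_X {s : ℕ} (y : Fin (s + 1) → MvPolynomial σ k)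
    (p : Polynomial (MvPolynomial (Fin s) k)) :
    aeval y ((finSuccEquiv k s).symm (p * Polynomial.X)) =
      y 0 * aeval y ((finSuccEquiv k s).symm p) := by
  have : (finSuccEquiv k s).symm Polynomial.X = X 0 := by
    rw [AlgEquiv.symm_apply_eq, finSuccEquiv_X_zero]
  rw [map_mul, map_mul, this, aeval_X, mul_comm]

/-- A graded basis modulo a regular linear form lifts. -/
theorem IsGradedBasis.lift {I J : Ideal (MvPolynomial σ k)} {s d : ℕ}
    {y : Fin (s + 1) → MvPolynomial σ k} {a : Fin d → ℕ} {b : Fin d → MvPolynomial σ k}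
    (h : IsGradedBasis (I ⊔ Ideal.span {y 0} * J) J (fun i => y i.succ) a b)
    (hI : I.IsHomogeneous (homogeneousSubmodule σ k)) (hy : ∀ i, (y i).IsHomogeneous 1)
    (hreg : ∀ p ∈ J, y 0 * p ∈ I → p ∈ I) : IsGradedBasis I J y a b where
  mem := h.mem
  hom := h.hom
  span := by
    -- Iterating the spanning property modulo `y 0` leaves a remainder divisible by `y 0 ^ N`;
    -- taking `N = t + 1` makes it invisible in degree `t`.
    have key : ∀ N, ∀ x ∈ J, ∃ c, ∃ i ∈ I, ∃ q ∈ J, x = combMap y b c + i + y 0 ^ N * q := by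
      intro N
      induction N with
      | zero => exact fun x hx => ⟨0, 0, I.zero_mem, x, hx, by simp⟩
      | succ N ih =>
        intro x hx
        obtain ⟨c, i, hi, q, hq, rfl⟩ := ih x hx
        obtain ⟨c', hc'⟩ := h.span q hq
        obtain ⟨i', hi', w, hw, hiw⟩ := Submodule.mem_sup.1 hc'
        obtain ⟨q', hq', rfl⟩ := Ideal.mem_span_singleton_mul.1 hw
        refine ⟨c + fun j => X 0 ^ N * rename Fin.succ (c' j), i + y 0 ^ N * i',
          I.add_mem hi (I.mul_mem_left _ hi'), q', hq', ?_⟩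
        have h1 : combMap y b (fun j => X 0 ^ N * rename Fin.succ (c' j)) =
            y 0 ^ N * combMap (fun i => y i.succ) b c' := by
          rw [combMap_apply, combMap_apply, Finset.mul_sum]
          refine Finset.sum_congr rfl fun j _ => ?_
          rw [map_mul, map_pow, aeval_X, aeval_rename, mul_assoc]
          rfl
        rw [map_add, h1, eq_add_of_sub_eq hiw.symm]
        ring
    have hle : J.restrictScalars k ≤ LinearMap.range (combMap y b) ⊔ I.restrictScalars k := by
      intro x hx
      rw [← sum_homogeneousComponent x]
      refine Submodule.sum_mem _ fun t _ => ?_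
      obtain ⟨c, i, hi, q, hq, hx'⟩ := key (t + 1) x hx
      rw [hx', map_add, map_add, homogeneousComponent_combMap hy h.hom,
        homogeneousComponent_mul_of_isHomogeneous ((hy 0).pow (t + 1)), if_neg (by omega), add_zero]
      exact Submodule.add_mem_sup ⟨_, rfl⟩ (homogeneousComponent_mem_of_mem hI hi t)
    intro x hx
    obtain ⟨_, ⟨c, rfl⟩, i, hi, rfl⟩ := Submodule.mem_sup.1 (hle hx)
    exact ⟨c, by simpa using hi⟩
  indep := by
    -- Induction on the degree in the first variable: independence modulo `y 0` kills the constant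
    -- coefficients, and regularity lets `y 0` be divided out.
    have key : ∀ N, ∀ p : Fin d → Polynomial (MvPolynomial (Fin s) k),
        (∀ i j, N ≤ j → (p i).coeff j = 0) →
        combMap y b (fun i => (finSuccEquiv k s).symm (p i)) ∈ I → p = 0 := by
      intro N
      induction N with
      | zero =>
        intro p hp _
        ext1 i
        ext1 j
        exact hp i j (Nat.zero_le _)
      | succ N ih =>
        intro p hp hpI
        have hdecomp : combMap y b (fun i => (finSuccEquiv k s).symm (p i)) =
            y 0 * combMap y b (fun i => (finSuccEquiv k s).symm (p i).divX) +
              combMap (fun i => y i.succ) b fun i => (p i).coeff 0 := by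
          rw [combMap_apply, combMap_apply, combMap_apply, Finset.mul_sum,
            ← Finset.sum_add_distrib]
          refine Finset.sum_congr rfl fun i _ => ?_
          conv_lhs => rw [← Polynomial.divX_mul_X_add (p i)]
          rw [map_add, map_add, aeval_finSuccEquiv_symm_mul_X, aeval_finSuccEquiv_symm_C]
          ring
        have hJ' : ∀ c, combMap y b c ∈ J := by
          intro c
          rw [combMap_apply]
          exact J.sum_mem fun i _ => J.mul_mem_left _ (h.mem i)
        have h0 : (fun i => (p i).coeff 0) = 0 := by
          refine h.indep _ ?_
          rw [← sub_eq_of_eq_add' hdecomp]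
          exact sub_mem (Ideal.mem_sup_left hpI) (Ideal.mem_sup_right
            (Ideal.mul_mem_mul (Ideal.mem_span_singleton_self _) (hJ' _)))
        rw [hdecomp, h0, map_zero, add_zero] at hpI
        have hdiv := ih (fun i => (p i).divX) (fun i j hj => by
          rw [Polynomial.coeff_divX]
          exact hp i _ (by omega)) (hreg _ (hJ' _) hpI)
        ext1 i
        rw [← Polynomial.divX_mul_X_add (p i), congrFun hdiv i, congrFun h0 i]
        simp
    intro c hc
    have hp := key (∑ i, (finSuccEquiv k s (c i)).natDegree + 1)
      (fun i => finSuccEquiv k s (c i)) (fun i j hj => by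
        refine Polynomial.coeff_eq_zero_of_natDegree_lt ?_
        have := Finset.single_le_sum (f := fun i => (finSuccEquiv k s (c i)).natDegree)
          (fun _ _ => Nat.zero_le _) (Finset.mem_univ i)
        omega) (by simpa using hc)
    ext1 i
    have := congrFun hp i
    simpa using this

/-- A graded basis of `J / I` modulo a regular sequence of linear forms lifts. -/
theorem IsGradedBasis.of_regQuot {I J : Ideal (MvPolynomial σ k)} {s d : ℕ}
    {y : Fin s → MvPolynomial σ k} {a : Fin d → ℕ} {b : Fin d → MvPolynomial σ k}
    (h : IsGradedBasis (regQuot I J (List.ofFn y)) J (Fin.elim0 : Fin 0 → MvPolynomial σ k) a b)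
    (hI : I.IsHomogeneous (homogeneousSubmodule σ k))
    (hJ : J.IsHomogeneous (homogeneousSubmodule σ k)) (hy : ∀ i, (y i).IsHomogeneous 1)
    (hreg : RegOn I J (List.ofFn y)) : IsGradedBasis I J y a b := by
  induction s generalizing I with
  | zero =>
    rw [Subsingleton.elim y Fin.elim0]
    simpa [regQuot] using h
  | succ s ih =>
    rw [List.ofFn_succ] at h hreg
    exact (ih h (hI.sup ((isHomogeneous_span_singleton (hy 0)).mul hJ)) (fun i => hy i.succ)
      hreg.2).lift hI hy hreg.1

theorem exists_gradedBasis_of_fg {Q J : Ideal (MvPolynomial σ k)}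
    (hJ : J.IsHomogeneous (homogeneousSubmodule σ k)) (W : Submodule k (MvPolynomial σ k))
    (hW : W.FG) (hJW : J.restrictScalars k ≤ W ⊔ Q.restrictScalars k) :
    ∃ (d : ℕ) (a : Fin d → ℕ) (b : Fin d → MvPolynomial σ k),
      IsGradedBasis Q J (Fin.elim0 : Fin 0 → MvPolynomial σ k) a b := by
  classical
  set mk : MvPolynomial σ k →ₗ[k] MvPolynomial σ k ⧸ Q := (Ideal.Quotient.mkₐ k Q).toLinearMap
  have hmk : ∀ p, mk p = 0 ↔ p ∈ Q := fun p => Ideal.Quotient.eq_zero_iff_mem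
  -- A basis extracted from the homogeneous classes, which span `J / Q`, consists of homogeneous
  -- elements.
  set T : Set (MvPolynomial σ k ⧸ Q) := {v | ∃ p ∈ J, ∃ e, p.IsHomogeneous e ∧ mk p = v} with hT
  obtain ⟨B, hBT, hspan, hli⟩ := exists_linearIndependent k T
  have hBW : Submodule.span k B ≤ W.map mk := by
    rw [hspan, Submodule.span_le]
    rintro _ ⟨p, hp, e, -, rfl⟩
    obtain ⟨w, hw, q, hq, rfl⟩ := Submodule.mem_sup.1 (hJW hp)
    exact ⟨w, hw, by rw [map_add, (hmk q).2 hq, add_zero]⟩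
  have hWfin : Module.Finite k (W.map mk) := Module.Finite.iff_fg.2 (hW.map mk)
  have hBfin : Module.Finite k (Submodule.span k B) := Submodule.finiteDimensional_of_le hBW
  have hspanB : Submodule.span k (Set.range ((↑) : B → MvPolynomial σ k ⧸ Q)) =
      Submodule.span k B := by rw [Subtype.range_coe]
  have hBfin' : Module.Finite k
      (Submodule.span k (Set.range ((↑) : B → MvPolynomial σ k ⧸ Q))) := by rwa [hspanB]
  have hfinite : Finite B := Module.Finite.finite_basis (Module.Basis.span hli)
  have e := Finite.equivFin B
  have hch : ∀ i, ∃ p ∈ J, ∃ t, p.IsHomogeneous t ∧ mk p = (e.symm i : MvPolynomial σ k ⧸ Q) :=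
    fun i => hBT (e.symm i).2
  choose b hbJ a hba hb using hch
  have hcomb : ∀ c : Fin (Nat.card B) → MvPolynomial (Fin 0) k,
      mk (combMap Fin.elim0 b c) = ∑ i, coeff 0 (c i) • (e.symm i : MvPolynomial σ k ⧸ Q) := by
    intro c
    rw [combMap_apply, map_sum]
    refine Finset.sum_congr rfl fun i _ => ?_
    rw [← hb i, ← map_smul]
    congr 1
    conv_lhs => rw [eq_C_of_isEmpty (c i)]
    rw [aeval_C, Algebra.smul_def]
  have hli' : LinearIndependent k fun i => (e.symm i : MvPolynomial σ k ⧸ Q) :=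
    hli.comp _ e.symm.injective
  refine ⟨Nat.card B, a, b, hbJ, hba, fun x hx => ?_, fun c hc => ?_⟩
  · have hxT : mk x ∈ Submodule.span k T := by
      rw [← sum_homogeneousComponent x, map_sum]
      exact Submodule.sum_mem _ fun t _ => Submodule.subset_span
        ⟨_, homogeneousComponent_mem_of_mem hJ hx t, t, homogeneousComponent_isHomogeneous t x, rfl⟩
    have hrange : Set.range (fun i => (e.symm i : MvPolynomial σ k ⧸ Q)) = B := by
      have : (fun i => (e.symm i : MvPolynomial σ k ⧸ Q)) = Subtype.val ∘ e.symm := rfl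
      rw [this, Set.range_comp, e.symm.surjective.range_eq, Set.image_univ, Subtype.range_coe]
    rw [← hspan, ← hrange, Submodule.mem_span_range_iff_exists_fun] at hxT
    obtain ⟨c, hc⟩ := hxT
    refine ⟨fun i => C (c i), ?_⟩
    rw [← hmk, map_sub, hcomb, ← hc]
    simp
  · rw [← hmk, hcomb] at hc
    have := Fintype.linearIndependent_iff.1 hli' _ hc
    ext1 i
    rw [eq_C_of_isEmpty (c i), this i]
    simp

/-- Lifts of a spanning set of `S / T`, multiplied by generators of `J`, span `J` modulo `T * J`. -/
theorem exists_fg_of_mul_le [Finite σ] {T J Q : Ideal (MvPolynomial σ k)}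
    [Module.Finite k (MvPolynomial σ k ⧸ T)] (h : T * J ≤ Q) :
    ∃ W : Submodule k (MvPolynomial σ k), W.FG ∧
      J.restrictScalars k ≤ W ⊔ Q.restrictScalars k := by
  classical
  set mk : MvPolynomial σ k →ₗ[k] MvPolynomial σ k ⧸ T := (Ideal.Quotient.mkₐ k T).toLinearMap
  have hmk : ∀ p, mk p = 0 ↔ p ∈ T := fun p => Ideal.Quotient.eq_zero_iff_mem
  have hsurj : Function.Surjective mk := Ideal.Quotient.mk_surjective
  obtain ⟨F, hF⟩ := (Module.finite_def (R := k) (M := MvPolynomial σ k ⧸ T)).1 inferInstance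
  obtain ⟨g, hg⟩ := hsurj.hasRightInverse
  obtain ⟨E, hE⟩ := IsNoetherian.noetherian J
  refine ⟨Submodule.span k (F.image g : Finset _) * Submodule.span k (E : Set _),
    Submodule.FG.mul ⟨_, rfl⟩ ⟨_, rfl⟩, ?_⟩
  have hlift : ∀ p, ∃ w ∈ Submodule.span k ((F.image g : Finset _) : Set (MvPolynomial σ k)),
      p - w ∈ T := by
    intro p
    have hmap : Submodule.map mk (Submodule.span k ((F.image g : Finset _) : Set _)) = ⊤ := by
      rw [Submodule.map_span, Finset.coe_image, ← Set.image_comp, ← hF]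
      congr 1
      convert Set.image_id _
      ext v
      exact hg v
    have hp : mk p ∈ (⊤ : Submodule k _) := trivial
    rw [← hmap] at hp
    obtain ⟨w, hw, hwp⟩ := hp
    exact ⟨w, hw, by rw [← hmk, map_sub, hwp, sub_self]⟩
  intro x hx
  have hx' : x ∈ J := hx
  rw [← hE, Submodule.mem_span_finset] at hx'
  obtain ⟨f, -, rfl⟩ := hx'
  refine Submodule.sum_mem _ fun z hz => ?_
  obtain ⟨w, hw, hpw⟩ := hlift (f z)
  have hzJ : z ∈ J := by
    rw [← hE]
    exact Submodule.subset_span hz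
  have : f z • z = w * z + (f z - w) * z := by rw [smul_eq_mul]; ring
  rw [this]
  exact Submodule.add_mem_sup (Submodule.mul_mem_mul hw (Submodule.subset_span hz))
    (h (Ideal.mul_mem_mul hpw hzJ))

/-- A graded basis may be reordered so that the degrees increase. -/
theorem IsGradedBasis.perm {I J : Ideal (MvPolynomial σ k)} {s d : ℕ}
    {y : Fin s → MvPolynomial σ k} {a : Fin d → ℕ} {b : Fin d → MvPolynomial σ k}
    (h : IsGradedBasis I J y a b) (e : Equiv.Perm (Fin d)) :
    IsGradedBasis I J y (a ∘ e) (b ∘ e) := by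
  have hc : ∀ c, combMap y (b ∘ e) (c ∘ e) = combMap y b c := by
    intro c
    rw [combMap_apply, combMap_apply]
    exact Equiv.sum_comp e fun i => aeval y (c i) * b i
  refine ⟨fun i => h.mem _, fun i => h.hom _, fun x hx => ?_, fun c hcI => ?_⟩
  · obtain ⟨c, hx⟩ := h.span x hx
    exact ⟨c ∘ e, by rwa [hc]⟩
  · have h1 : c = (c ∘ e.symm) ∘ e := by ext1 i; simp
    rw [h1, hc] at hcI
    rw [h1, h.indep _ hcI]
    rfl

/-- Existence of graded bases. -/
theorem exists_gradedBasis [Finite σ] {I J T : Ideal (MvPolynomial σ k)} {s : ℕ}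
    {y : Fin s → MvPolynomial σ k} (hI : I.IsHomogeneous (homogeneousSubmodule σ k))
    (hJ : J.IsHomogeneous (homogeneousSubmodule σ k)) (hy : ∀ i, (y i).IsHomogeneous 1)
    (hreg : RegOn I J (List.ofFn y)) (hfin : Module.Finite k (MvPolynomial σ k ⧸ T))
    (hT : T * J ≤ regQuot I J (List.ofFn y)) :
    ∃ (d : ℕ) (a : Fin d → ℕ) (b : Fin d → MvPolynomial σ k), Monotone a ∧
      IsGradedBasis I J y a b ∧ IsGradedBasis (regQuot I J (List.ofFn y)) J
        (Fin.elim0 : Fin 0 → MvPolynomial σ k) a b := by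
  obtain ⟨W, hW, hJW⟩ := exists_fg_of_mul_le hT
  obtain ⟨d, a, b, hb⟩ := exists_gradedBasis_of_fg hJ W hW hJW
  have hb' := hb.perm (Tuple.sort a)
  exact ⟨d, _, _, Tuple.monotone_sort a, hb'.of_regQuot hI hJ hy hreg, hb'⟩

end GradedBasis

/-! ### Generating functions of characteristic sequences -/

section Sequences

/-- The generating function `∑ X^{a_i}` of a sequence. -/
noncomputable def seqSeries {d : ℕ} (a : Fin d → ℕ) : PowerSeries ℤ :=
  ∑ i, PowerSeries.X ^ a i

/-- The Hilbert series of the polynomial ring in `s` variables. -/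
noncomputable def polySeries (s : ℕ) : PowerSeries ℤ :=
  PowerSeries.mk fun t => (s.multichoose t : ℤ)

theorem coeff_seqSeries_mul {d : ℕ} (a : Fin d → ℕ) (s t : ℕ) :
    PowerSeries.coeff t (seqSeries a * polySeries s) =
      ((∑ i, if a i ≤ t then s.multichoose (t - a i) else 0 : ℕ) : ℤ) := by
  rw [seqSeries, Finset.sum_mul, map_sum, Nat.cast_sum]
  refine Finset.sum_congr rfl fun i _ => ?_
  rw [PowerSeries.coeff_X_pow_mul', polySeries]
  split_ifs <;> simp

theorem coeff_seqSeries {d : ℕ} (a : Fin d → ℕ) (t : ℕ) :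
    PowerSeries.coeff t (seqSeries a) = (width a t : ℤ) := by
  rw [seqSeries, map_sum, width, Finset.card_filter, Nat.cast_sum]
  refine Finset.sum_congr rfl fun i _ => ?_
  rw [PowerSeries.coeff_X_pow]
  simp [eq_comm]

theorem coeff_seqSeries_mul_one {d : ℕ} (a : Fin d → ℕ) (t : ℕ) :
    PowerSeries.coeff t (seqSeries a * polySeries 1) = (cumWidth a t : ℤ) := by
  rw [coeff_seqSeries_mul, cumWidth, Finset.card_filter]
  simp only [Nat.multichoose_one]

theorem polySeries_zero : polySeries 0 = 1 := by
  ext t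
  rw [polySeries, PowerSeries.coeff_mk, PowerSeries.coeff_one]
  cases t <;> simp [Nat.multichoose_zero_succ]

/-- Thus `polySeries s` is `(1 - X)^{-s}`, which allows comparing free modules over `r + 1` and over
`r` variables. -/
theorem polySeries_succ (s : ℕ) :
    polySeries (s + 1) * (1 - PowerSeries.X) = polySeries s := by
  rw [mul_sub, mul_one, sub_eq_iff_eq_add]
  ext t
  cases t with
  | zero => simp [polySeries]
  | succ t =>
    rw [map_add, PowerSeries.coeff_succ_mul_X]
    simp only [polySeries, PowerSeries.coeff_mk]
    rw [Nat.multichoose_succ_succ]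
    push_cast
    ring

theorem polySeries_ne_zero (s : ℕ) : polySeries s ≠ 0 := by
  intro h
  have := congrArg (PowerSeries.coeff 0) h
  simp [polySeries] at this

theorem count_map_eq_width {d : ℕ} (a : Fin d → ℕ) (t : ℕ) :
    Multiset.count t (Multiset.map a Finset.univ.val) = width a t := by
  rw [Multiset.count_map, width, Finset.card_def, Finset.filter_val]
  simp only [eq_comm]

/-- An increasing sequence is determined by its widths. -/
theorem eq_of_width_eq {d e : ℕ} {a : Fin e → ℕ} {m : Fin d → ℕ} (ha : Monotone a)
    (hm : Monotone m) (h : ∀ t, width a t = width m t) :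
    ∃ h : e = d, ∀ i, a i = m (Fin.cast h i) := by
  have hms : Multiset.map a Finset.univ.val = Multiset.map m Finset.univ.val := by
    ext t
    rw [count_map_eq_width, count_map_eq_width, h]
  have hed : e = d := by
    have := congrArg Multiset.card hms
    simpa using this
  subst hed
  refine ⟨rfl, fun i => ?_⟩
  have hperm : (List.ofFn a).Perm (List.ofFn m) := by
    rw [← Multiset.coe_eq_coe]
    rw [Fin.univ_val_map, Fin.univ_val_map] at hms
    exact hms
  have heq : List.ofFn a = List.ofFn m :=
    hperm.eq_of_pairwise' ha.sortedLE_ofFn.pairwise hm.sortedLE_ofFn.pairwise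
  exact congrFun (List.ofFn_injective heq) i

/-- If `ν i < m i`, then at level `ν i` at least `i + 1` terms of `ν` but at most `i` terms of `m`
have been counted. -/
theorem le_of_cumWidth_le {d : ℕ} {m ν : Fin d → ℕ} (hm : Monotone m) (hν : Monotone ν)
    (h : ∀ t, cumWidth ν t ≤ cumWidth m t) (i : Fin d) : m i ≤ ν i := by
  by_contra! hlt
  have h1 : (Finset.Iic i).card ≤ cumWidth ν (ν i) := by
    refine Finset.card_le_card fun j hj => ?_
    exact Finset.mem_filter.2 ⟨Finset.mem_univ j, hν (Finset.mem_Iic.1 hj)⟩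
  have h2 : cumWidth m (ν i) ≤ (Finset.Iio i).card := by
    refine Finset.card_le_card fun j hj => ?_
    have := (Finset.mem_filter.1 hj).2
    rw [Finset.mem_Iio]
    by_contra! hij
    exact absurd ((hm hij).trans this) (not_le.2 hlt)
  have := h (ν i)
  rw [Fin.card_Iic] at h1
  rw [Fin.card_Iio] at h2
  omega

theorem map_eq_sum_Ico {d d' : ℕ} {m ν : Fin d → ℕ} {m' : Fin d' → ℕ} (hle : ∀ i, m i ≤ ν i)
    (h : ∀ t, cumWidth m t = cumWidth ν t + width m' t) :
    Multiset.map m' Finset.univ.val = ∑ i, Multiset.Ico (m i) (ν i) := by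
  ext t
  rw [count_map_eq_width, Multiset.count_sum']
  have hcount : ∀ i, Multiset.count t (Multiset.Ico (m i) (ν i)) + (if ν i ≤ t then 1 else 0) =
      if m i ≤ t then 1 else 0 := by
    intro i
    rw [Multiset.count_eq_of_nodup Multiset.nodup_Ico]
    simp only [Multiset.mem_Ico]
    have := hle i
    split_ifs <;> omega
  have hsum := Finset.sum_congr (rfl : (Finset.univ : Finset (Fin d)) = Finset.univ)
    fun i _ => hcount i
  rw [Finset.sum_add_distrib] at hsum
  have := h t
  rw [cumWidth, cumWidth, Finset.card_filter, Finset.card_filter] at this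
  omega

theorem cumWidth_eq_of_le {d : ℕ} (a : Fin d → ℕ) (t : ℕ) (h : ∑ i, a i ≤ t) :
    cumWidth a t = d := by
  rw [cumWidth, Finset.filter_true_of_mem, Finset.card_univ, Fintype.card_fin]
  exact fun i _ => (Finset.single_le_sum (fun _ _ => Nat.zero_le _) (Finset.mem_univ i)).trans h

theorem width_eq_zero_of_lt {d : ℕ} (a : Fin d → ℕ) (t : ℕ) (h : ∑ i, a i < t) :
    width a t = 0 := by
  rw [width, Finset.card_eq_zero, Finset.filter_eq_empty_iff]
  intro i _ hi
  have := Finset.single_le_sum (f := a) (fun _ _ => Nat.zero_le _) (Finset.mem_univ i)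
  omega

end Sequences

/-! ### Characteristic sequences -/

section CharSeq

variable {k : Type*} [Field k] {n : ℕ}

attribute [local instance] MvPolynomial.gradedAlgebra

theorem mk_combMap (I : Ideal (MvPolynomial (Fin (n + 1)) k)) {s d : ℕ}
    (y : Fin s → MvPolynomial (Fin (n + 1)) k) (b : Fin d → MvPolynomial (Fin (n + 1)) k)
    (c : Fin d → MvPolynomial (Fin s) k) :
    Ideal.Quotient.mk I (combMap y b c) =
      ∑ i, Ideal.Quotient.mk I (aeval y (c i)) * Ideal.Quotient.mk I (b i) := by
  rw [combMap_apply, map_sum]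
  exact Finset.sum_congr rfl fun i _ => map_mul _ _ _

theorem IsGradedBasis.hasGradedBasis {I J : Ideal (MvPolynomial (Fin (n + 1)) k)} {s d : ℕ}
    {y : Fin s → MvPolynomial (Fin (n + 1)) k} {a : Fin d → ℕ}
    {b : Fin d → MvPolynomial (Fin (n + 1)) k} (h : IsGradedBasis I J y a b) :
    HasGradedBasis I (Submodule.map I.mkQ J) y a := by
  refine ⟨fun i => Ideal.Quotient.mk I (b i), fun i => ⟨⟨b i, h.mem i, rfl⟩, b i, h.hom i, rfl⟩,
    ?_⟩
  rintro _ ⟨x, hx, rfl⟩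
  obtain ⟨c, hc⟩ := h.span x hx
  have hmk : Ideal.Quotient.mk I x = Ideal.Quotient.mk I (combMap y b c) :=
    Ideal.Quotient.eq.2 hc
  refine ⟨c, ?_, fun c' hc' => ?_⟩
  · exact (mk_combMap I y b c).symm.trans hmk.symm
  · have h1 : Ideal.Quotient.mk I (combMap y b c') = Ideal.Quotient.mk I (combMap y b c) := by
      rw [mk_combMap, ← hmk]
      exact hc'
    rw [Ideal.Quotient.eq, ← map_sub] at h1
    exact sub_eq_zero.1 (h.indep _ h1)

theorem HasGradedBasis.exists_isGradedBasis {I J : Ideal (MvPolynomial (Fin (n + 1)) k)}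
    (hIJ : I ≤ J) {s d : ℕ} {y : Fin s → MvPolynomial (Fin (n + 1)) k} {a : Fin d → ℕ}
    (h : HasGradedBasis I (Submodule.map I.mkQ J) y a) : ∃ b, IsGradedBasis I J y a b := by
  obtain ⟨b, hb, huniq⟩ := h
  choose hbJ p hp hpb using hb
  have hbp : b = fun i => Ideal.Quotient.mk I (p i) := funext fun i => (hpb i).symm
  subst hbp
  refine ⟨p, fun i => ?_, hp, fun x hx => ?_, fun c hc => ?_⟩
  · obtain ⟨q, hq, hqp⟩ := hbJ i
    have : q - p i ∈ I := Ideal.Quotient.eq.1 hqp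
    have := J.sub_mem hq (hIJ this)
    rwa [sub_sub_cancel] at this
  · obtain ⟨c, hc, -⟩ := huniq (Ideal.Quotient.mk I x) ⟨x, hx, rfl⟩
    refine ⟨c, Ideal.Quotient.eq.1 ?_⟩
    rw [mk_combMap]
    exact hc.symm
  · obtain ⟨c₀, -, hc₀⟩ := huniq 0 (zero_mem _)
    have h1 : c = c₀ := hc₀ c (by
      show ∑ i, _ = _
      rw [← mk_combMap]
      exact Ideal.Quotient.eq_zero_iff_mem.2 hc)
    have h2 : (0 : Fin d → MvPolynomial (Fin s) k) = c₀ := hc₀ 0 (by simp)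
    rw [h1, h2]

theorem homogDim_eq_coeff {I J : Ideal (MvPolynomial (Fin (n + 1)) k)} {s d : ℕ}
    {y : Fin s → MvPolynomial (Fin (n + 1)) k} {a : Fin d → ℕ}
    {b : Fin d → MvPolynomial (Fin (n + 1)) k} (h : IsGradedBasis I J y a b)
    (hI : I.IsHomogeneous (homogeneousSubmodule _ k)) (hIJ : I ≤ J)
    (hy : ∀ i, (y i).IsHomogeneous 1) (t : ℕ) :
    (homogDim J t : ℤ) = homogDim I t + PowerSeries.coeff t (seqSeries a * polySeries s) := by
  rw [h.homogDim_eq hI hIJ hy, coeff_seqSeries_mul]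
  push_cast
  rfl

/-- The degrees of a graded basis do not depend on the basis or the linear forms. -/
theorem IsGradedBasis.eq_of_monotone {I J : Ideal (MvPolynomial (Fin (n + 1)) k)} {s d e : ℕ}
    {y : Fin s → MvPolynomial (Fin (n + 1)) k} {m : Fin d → ℕ}
    {b : Fin d → MvPolynomial (Fin (n + 1)) k} (h : IsGradedBasis I J y m b)
    (hI : I.IsHomogeneous (homogeneousSubmodule _ k)) (hIJ : I ≤ J)
    (hy : ∀ i, (y i).IsHomogeneous 1) (hm : Monotone m) {a : Fin e → ℕ} (ha : Monotone a)
    {z : Fin s → MvPolynomial (Fin (n + 1)) k} (hz : ∀ i, (z i).IsHomogeneous 1)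
    (hK : HasGradedBasis I (Submodule.map I.mkQ J) z a) :
    ∃ h : e = d, ∀ i, a i = m (Fin.cast h i) := by
  obtain ⟨b', hb'⟩ := hK.exists_isGradedBasis hIJ
  have heq : seqSeries a * polySeries s = seqSeries m * polySeries s := by
    ext t
    have h1 := homogDim_eq_coeff h hI hIJ hy t
    have h2 := homogDim_eq_coeff hb' hI hIJ hz t
    linarith
  refine eq_of_width_eq ha hm fun t => ?_
  have h1 := congrArg (PowerSeries.coeff t) (mul_right_cancel₀ (polySeries_ne_zero s) heq)
  rw [coeff_seqSeries, coeff_seqSeries] at h1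
  exact_mod_cast h1

theorem homogDim_zero_of_ne_top {J : Ideal (MvPolynomial (Fin (n + 1)) k)} (hJ : J ≠ ⊤) :
    homogDim J 0 = 0 := by
  have : homogPart J 0 = ⊥ := by
    rw [eq_bot_iff]
    intro p hp
    obtain ⟨h1, h2⟩ := mem_homogPart.1 hp
    have h3 := homogeneousComponent_eq_self h1
    rw [homogeneousComponent_zero] at h3
    rw [Submodule.mem_bot]
    by_contra hp0
    refine hJ (Ideal.eq_top_of_isUnit_mem _ h2 ?_)
    rw [← h3] at hp0 ⊢
    exact (IsUnit.mk0 _ fun h => hp0 (by rw [h, C_0])).map C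
  rw [homogDim, this, finrank_bot]

theorem isHomogeneous_of_isACMCone {I : Ideal (MvPolynomial (Fin (n + 1)) k)} {r : ℕ}
    (h : IsACMCone I r) : I.IsHomogeneous (homogeneousSubmodule _ k) := by
  obtain ⟨s, hs, rfl⟩ := h.isHomogeneous
  exact Ideal.homogeneous_span _ _ hs

theorem ringKrullDim_le_of_coneHasDim {I : Ideal (MvPolynomial (Fin (n + 1)) k)} {r : ℕ}
    (h : ConeHasDim I r) :
    ringKrullDim (MvPolynomial (Fin (n + 1)) k ⧸ I) ≤ (r : WithBot ℕ∞) := by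
  rcases h with rfl | h
  · have : Subsingleton (MvPolynomial (Fin (n + 1)) k ⧸ (⊤ : Ideal _)) :=
      Ideal.Quotient.subsingleton_iff.2 rfl
    rw [ringKrullDim_eq_bot_of_subsingleton]
    exact bot_le
  · exact h.le

theorem IsACMCone.exists_regOn {I : Ideal (MvPolynomial (Fin (n + 1)) k)} {r : ℕ}
    (h : IsACMCone I r) : ∃ f : List (MvPolynomial (Fin (n + 1)) k), f.length = r ∧
      (∀ a ∈ f, ∃ e, 0 < e ∧ a.IsHomogeneous e) ∧ RegOn I ⊤ f := by
  obtain ⟨f, hf, hreg⟩ := h.exists_regular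
  refine ⟨List.ofFn f, List.length_ofFn, fun a ha => ?_, (isWeaklyRegular_iff_regOn I _).1 hreg⟩
  obtain ⟨i, rfl⟩ := (List.mem_ofFn' _ _).1 ha
  exact hf i

theorem List.exists_ofFn_eq {α : Type*} {r : ℕ} (l : List α) (h : l.length = r) :
    ∃ y : Fin r → α, List.ofFn y = l := by
  subst h
  exact ⟨l.get, List.ofFn_get l⟩

/-- The widths of `Y` are the differences of the accumulated widths of `X` and of `Y` in `X`. -/
theorem cumWidth_eq_add {I J : Ideal (MvPolynomial (Fin (n + 1)) k)} {r d₁ d₂ d' : ℕ}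
    {m : Fin d₁ → ℕ} {ν : Fin d₂ → ℕ} {m' : Fin d' → ℕ}
    {y₁ y₂ : Fin (r + 1) → MvPolynomial (Fin (n + 1)) k} {z : Fin r → MvPolynomial (Fin (n + 1)) k}
    {b₁ b₂ b'} (hI : I.IsHomogeneous (homogeneousSubmodule _ k))
    (hJ : J.IsHomogeneous (homogeneousSubmodule _ k)) (hIJ : I ≤ J)
    (hy₁ : ∀ i, (y₁ i).IsHomogeneous 1) (hy₂ : ∀ i, (y₂ i).IsHomogeneous 1)
    (hz : ∀ i, (z i).IsHomogeneous 1) (hm : IsGradedBasis I ⊤ y₁ m b₁)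
    (hν : IsGradedBasis I J y₂ ν b₂) (hm' : IsGradedBasis J ⊤ z m' b') (t : ℕ) :
    cumWidth m t = cumWidth ν t + width m' t := by
  have heq : seqSeries m * polySeries (r + 1) =
      (seqSeries ν + seqSeries m' * (1 - PowerSeries.X)) * polySeries (r + 1) := by
    rw [add_mul, mul_assoc, mul_comm (1 - PowerSeries.X), polySeries_succ]
    ext u
    have h1 := homogDim_eq_coeff hm hI le_top hy₁ u
    have h2 := homogDim_eq_coeff hν hI hIJ hy₂ u
    have h3 := homogDim_eq_coeff hm' hJ le_top hz u
    rw [map_add]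
    linarith
  have h1 := mul_right_cancel₀ (polySeries_ne_zero _) heq
  -- Multiplying by `polySeries 1 = 1 / (1 - X)` accumulates the widths of `m` and `ν` and cancels
  -- the factor `1 - X` on `m'`.
  have h2 := congrArg (fun p => PowerSeries.coeff t (p * polySeries 1)) h1
  simp only [add_mul, mul_assoc] at h2
  rw [mul_comm (1 - PowerSeries.X), polySeries_succ, polySeries_zero, mul_one, map_add,
    coeff_seqSeries_mul_one, coeff_seqSeries_mul_one, coeff_seqSeries] at h2
  exact_mod_cast h2

/-- Over zero variables the coefficient ring is `k`, so `width a` is the Hilbert function of the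
quotient by `Q`. -/
theorem isOSequence_width {Q : Ideal (MvPolynomial (Fin (n + 1)) k)} {d : ℕ} {a : Fin d → ℕ}
    {b : Fin d → MvPolynomial (Fin (n + 1)) k}
    (h : IsGradedBasis Q ⊤ (Fin.elim0 : Fin 0 → MvPolynomial (Fin (n + 1)) k) a b)
    (hQ : Q.IsHomogeneous (homogeneousSubmodule _ k)) : IsOSequence (width a) := by
  refine isOSequence_hilbert Q _ fun t => ?_
  have h1 := homogDim_eq_coeff h hQ le_top (fun i => i.elim0) t
  rw [polySeries_zero, mul_one, coeff_seqSeries] at h1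
  omega

theorem width_zero_eq_one {J : Ideal (MvPolynomial (Fin (n + 1)) k)} {s d : ℕ}
    {y : Fin s → MvPolynomial (Fin (n + 1)) k} {a : Fin d → ℕ}
    {b : Fin d → MvPolynomial (Fin (n + 1)) k} (h : IsGradedBasis J ⊤ y a b)
    (hJ : J.IsHomogeneous (homogeneousSubmodule _ k)) (hy : ∀ i, (y i).IsHomogeneous 1)
    (hne : J ≠ ⊤) : width a 0 = 1 := by
  have h1 := h.homogDim_eq hJ le_top hy 0
  rw [homogDim_zero_of_ne_top hne, homogDim, homogPart_top, finrank_homogeneousSubmodule] at h1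
  rw [width, Finset.card_filter]
  simpa using h1.symm

end CharSeq

/-! ### The main theorem -/

theorem mainTheorem5 {k : Type*} [Field k] [IsAlgClosed k] [CharZero k] (n r : ℕ)
    (I J : Ideal (MvPolynomial (Fin (n + 1)) k))
    (hX : IsACMCone I (r + 1)) (hY : IsACMCone J r) (hYX : I ≤ J) :
    ∃ (d d' : ℕ) (m ν : Fin d → ℕ) (m' : Fin d' → ℕ),
      -- `m` is the characteristic sequence of `X`
      IsCharSeq I (r + 1) m ∧
      (∀ (e : ℕ) (a : Fin e → ℕ), IsCharSeq I (r + 1) a →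
        ∃ h : e = d, ∀ i, a i = m (Fin.cast h i)) ∧
      -- `ν` is the characteristic sequence of `Y` relative to `X`
      IsRelCharSeq I J (r + 1) ν ∧
      (∀ (e : ℕ) (a : Fin e → ℕ), IsRelCharSeq I J (r + 1) a →
        ∃ h : e = d, ∀ i, a i = ν (Fin.cast h i)) ∧
      -- `m'` is the absolute characteristic sequence of `Y`
      IsCharSeq J r m' ∧
      (∀ (e : ℕ) (a : Fin e → ℕ), IsCharSeq J r a →
        ∃ h : e = d', ∀ i, a i = m' (Fin.cast h i)) ∧
      (∀ i, m i ≤ ν i) ∧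
      Multiset.map m' Finset.univ.val = ∑ i, Multiset.Ico (m i) (ν i) ∧
      (∀ i : ℕ, (width m' i : ℤ) = (cumWidth m i : ℤ) - (cumWidth ν i : ℤ)) ∧
      IsOSequence (width m') ∧ (J ≠ ⊤ → width m' 0 = 1) := by
  have hI := isHomogeneous_of_isACMCone hX
  have hJ := isHomogeneous_of_isACMCone hY
  obtain ⟨f, hfl, hf, hIf⟩ := hX.exists_regOn
  obtain ⟨g, hgl, hg, hJg⟩ := hY.exists_regOn
  obtain ⟨l, z, hl, hl1, hz, hIl, hJl⟩ := exists_linear_regOn r hI hJ f g hf hg hfl hgl hIf hJg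
  obtain ⟨y, hyl⟩ := List.exists_ofFn_eq (l ++ [z]) (by simp [hl] : (l ++ [z]).length = r + 1)
  obtain ⟨w, hwl⟩ := List.exists_ofFn_eq l hl
  have hy : ∀ i, (y i).IsHomogeneous 1 := by
    intro i
    have : y i ∈ l ++ [z] := by rw [← hyl]; exact (List.mem_ofFn' _ _).2 ⟨i, rfl⟩
    rcases List.mem_append.1 this with h | h
    · exact hl1 _ h
    · rwa [List.mem_singleton.1 h]
  have hw : ∀ i, (w i).IsHomogeneous 1 := by
    intro i
    exact hl1 _ (by rw [← hwl]; exact (List.mem_ofFn' _ _).2 ⟨i, rfl⟩)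
  have hK : RegOn I J (List.ofFn y) := by
    have := regOn_kernel I J l z hIl (by rwa [sup_eq_left.2 hYX])
    rwa [inf_eq_right.2 hYX, ← hyl] at this
  rw [← hyl] at hIl
  rw [← hwl] at hJl
  have hTI := finite_quotient_regQuot I _ hIl
    (by simpa using ringKrullDim_le_of_coneHasDim hX.hasDim)
  have hTJ := finite_quotient_regQuot J _ hJl
    (by simpa using ringKrullDim_le_of_coneHasDim hY.hasDim)
  obtain ⟨d, m, b, hm, hb, -⟩ := exists_gradedBasis hI isHomogeneous_top hy hIl hTI
    Ideal.mul_le_left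
  obtain ⟨d₂, ν, b₂, hν, hb₂, -⟩ := exists_gradedBasis hI hJ hy hK hTI
    (regQuot_mul_le J Ideal.mul_le_left _)
  obtain ⟨d', m', b', hm', hb', hb₀⟩ := exists_gradedBasis hJ isHomogeneous_top hw hJl hTJ
    Ideal.mul_le_left
  have hcum := cumWidth_eq_add hI hJ hYX hy hy hw hb hb₂ hb'
  -- Beyond all entries, `width m'` vanishes and the accumulated widths equal the lengths.
  obtain rfl : d = d₂ := by
    have h1 := hcum (∑ i, m i + ∑ i, ν i + ∑ i, m' i + 1)
    rwa [cumWidth_eq_of_le m _ (by omega), cumWidth_eq_of_le ν _ (by omega),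
      width_eq_zero_of_lt m' _ (by omega), add_zero] at h1
  have htop : ∀ I' : Ideal (MvPolynomial (Fin (n + 1)) k), Submodule.map I'.mkQ ⊤ = ⊤ := by
    intro I'
    rw [Submodule.map_top, Submodule.range_mkQ]
  have hle := le_of_cumWidth_le hm hν fun t => by rw [hcum t]; exact Nat.le_add_right _ _
  refine ⟨d, d', m, ν, m', ⟨hm, y, ⟨hy, (isWeaklyRegular_iff_regOn I _).2 hIl⟩, ?_⟩, ?_,
    ⟨hν, y, ⟨hy, (isWeaklyRegular_iff_regOn I _).2 hIl⟩, hb₂.hasGradedBasis⟩, ?_,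
    ⟨hm', w, ⟨hw, (isWeaklyRegular_iff_regOn J _).2 hJl⟩, ?_⟩, ?_, hle,
    map_eq_sum_Ico hle hcum, fun t => ?_, ?_, fun hne => width_zero_eq_one hb' hJ hw hne⟩
  · rw [← htop I]
    exact hb.hasGradedBasis
  · rintro e a ⟨ha, y', ⟨hy', -⟩, h⟩
    rw [← htop I] at h
    exact hb.eq_of_monotone hI le_top hy hm ha hy' h
  · rintro e a ⟨ha, y', ⟨hy', -⟩, h⟩
    exact hb₂.eq_of_monotone hI hYX hy hν ha hy' h
  · rw [← htop J]
    exact hb'.hasGradedBasis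
  · rintro e a ⟨ha, y', ⟨hy', -⟩, h⟩
    rw [← htop J] at h
    exact hb'.eq_of_monotone hJ le_top hw hm' ha hy' h
  · have := hcum t
    omega
  -- The degrees `m'` also index a `k`-basis of the quotient of `A_Y` by its linear regular
  -- sequence.
  · refine isOSequence_width hb₀ (isHomogeneous_regQuot hJ isHomogeneous_top _ fun v hv => ?_)
    rw [hwl] at hv
    exact ⟨1, hl1 v hv⟩
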